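/- Let $n\ge 2$, let $\Gamma$ be a commutative semigroup (written additively) and let $T$ be an $n$-ary $\Gamma$-semiring: a commutative monoid $(T,+,0)$ with an operation $T^n\times\Gamma^{n-1}\to T$, $(x_1,\dots,x_n;\gamma_1,\dots,\gamma_{n-1})\mapsto[x_1,\dots,x_n]_{\gamma_1,\dots,\gamma_{n-1}}$, which is additive in each $x_i$, vanishes if some $x_i=0$, and is associative: the value of an iterated product depends only on the underlying word $x_1\gamma_1x_2\gamma_2\cdots\gamma_{m-1}x_m$, not on the bracketing. Fix slots $j,k\in\{1,\dots,n\}$. A left $\Gamma$-module (slot $j$) is an abelian group $M$ with an action $\mu^{(j)}:T^{n-1}\times M\times\Gamma^{n-1}\to M$, the module element being inserted into slot $j$ of the $n$-ary product and the remaining slots being filled, in order, by the elements of $T$. The action is additive in the module element and in each $T$-variable, additive in the parameter vector $(\gamma_1,\dots,\gamma_{n-1})\in\Gamma^{n-1}$, vanishes if one of the elements of $T$ or the module element is $0$, and is associative: for a word with exactly one letter from $M$, all bracketings in which the module element always stands in slot $j$ have the same value. A right $\Gamma$-module (slot $k$) is defined in the same way with $k$ in place of $j$. A bi-$\Gamma$-module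 is an abelian group with a left action in slot $j$ and a right action in slot $k$, satisfying these conditions, such that all bracketings of a word with one module letter that can be evaluated by means of the two actions have the same value. Morphisms are the additive maps preserving the actions. Let $\mathcal B$ be the category of bi-$\Gamma$-modules; it is abelian with enough projectives and enough injectives. For bi-$\Gamma$-modules $M,X$ let $\mathrm{Hom}^{(j,k)}_\Gamma(M,X)$ be the abelian group of morphisms $M\to X$ in $\mathcal B$. For a left module $M$ and a right module $N$ let $M\otimes^{(j,k)}_\Gamma N$ be the quotient of $M\otimes_{\mathbb Z}N$ by the relations $\mu^{(j)}(a;m;\gamma)\otimes y=m\otimes\mu^{(k)}(a;y;\gamma)$ for $a\in T^{n-1}$, $\gamma\in\Gamma^{n-1}$, $m\in M$, $y\in N$. Define functors on $\mathcal B$, for $r\ge0$: for a bi-module $M$, $\mathrm{Ext}^{r}_{(j,k),\Gamma}(M,-)$ is the $r$-th right derived functor of $\mathrm{Hom}^{(j,k)}_\Gamma(M,-)$ (it is also contravariantly functorial in $M$); for a right module $N$, $\mathrm{Tor}_r^{(j,k),\Gamma}(-,N)$ is the $r$-th left derived functor of $X\mapsto X\otimes^{(j,k)}_\Gamma N$ ($X$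 regarded as a left module); for a left module $M$, $\mathrm{Tor}_r^{(j,k),\Gamma}(M,-)$ is the $r$-th left derived functor of $X\mapsto M\otimes^{(j,k)}_\Gamma X$ ($X$ regarded as a right module). Then the canonical natural transformations $\mathrm{Hom}^{(j,k)}_\Gamma(M,-)\to\mathrm{Ext}^0_{(j,k),\Gamma}(M,-)$, $\mathrm{Tor}_0^{(j,k),\Gamma}(-,N)\to-\otimes^{(j,k)}_\Gamma N$ and $\mathrm{Tor}_0^{(j,k),\Gamma}(M,-)\to M\otimes^{(j,k)}_\Gamma-$ are isomorphisms, and for every short exact sequence $0\to A\to B\to C\to0$ in $\mathcal B$ there are long exact sequences of abelian groups, natural in the short exact sequence: 1. for every bi-module $M$, $$0\to\mathrm{Ext}^0_{(j,k),\Gamma}(M,A)\to\mathrm{Ext}^0_{(j,k),\Gamma}(M,B)\to\mathrm{Ext}^0_{(j,k),\Gamma}(M,C)\to\mathrm{Ext}^1_{(j,k),\Gamma}(M,A)\to\mathrm{Ext}^1_{(j,k),\Gamma}(M,B)\to\cdots;$$ 2. for every bi-module $N$, $$0\to\mathrm{Ext}^0_{(j,k),\Gamma}(C,N)\to\mathrm{Ext}^0_{(j,k),\Gamma}(B,N)\to\mathrm{Ext}^0_{(j,k),\Gamma}(A,N)\to\mathrm{Ext}^1_{(j,k),\Gamma}(C,N)\to\mathrm{Ext}^1_{(j,k),\Gamma}(B,N)\to\cdots;$$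 3. for every right module $N$, $$\cdots\to\mathrm{Tor}_1^{(j,k),\Gamma}(B,N)\to\mathrm{Tor}_1^{(j,k),\Gamma}(C,N)\to\mathrm{Tor}_0^{(j,k),\Gamma}(A,N)\to\mathrm{Tor}_0^{(j,k),\Gamma}(B,N)\to\mathrm{Tor}_0^{(j,k),\Gamma}(C,N)\to0;$$ 4. for every left module $M$, $$\cdots\to\mathrm{Tor}_1^{(j,k),\Gamma}(M,B)\to\mathrm{Tor}_1^{(j,k),\Gamma}(M,C)\to\mathrm{Tor}_0^{(j,k),\Gamma}(M,A)\to\mathrm{Tor}_0^{(j,k),\Gamma}(M,B)\to\mathrm{Tor}_0^{(j,k),\Gamma}(M,C)\to0.$$ -/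

import Mathlib

open CategoryTheory CategoryTheory.Limits TensorProduct

universe u v w

/-! ### Bracketings and `(d + 1)`-ary `Γ`-semirings

The arity is written `n = d + 1`, so that an `n`-ary product involves `n` elements of `T` and
`d = n - 1` parameters from `Γ`.  A word is an alternating string `x₁ γ₁ x₂ γ₂ … γₘ xₘ₊₁`, written
as a list of letters from `T ⊕ Γ`. -/

/-- A complete bracketing by `(d + 1)`-ary operations with entries in `T` and parameters in `Γ`. -/
inductive Bracketing (d : ℕ) (T : Type u) (Γ : Type v) : Type (max u v)
  | leaf (x : T) : Bracketing d T Γ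
  | node (c : Fin (d + 1) → Bracketing d T Γ) (γ : Fin d → Γ) : Bracketing d T Γ

namespace Bracketing

variable {d : ℕ} {T : Type u} {Γ : Type v}

/-- The underlying word; for a node with children `c₀, …, c_d` it is `c₀ γ₀ c₁ γ₁ … γ_{d-1} c_d`. -/
def word : Bracketing d T Γ → List (T ⊕ Γ)
  | leaf x => [Sum.inl x]
  | node c γ =>
      (c 0).word ++ (List.finRange d).flatMap fun i => Sum.inr (γ i) :: (c i.succ).word

/-- The value of a bracketing under an operation `μ`. -/
def eval (μ : (Fin (d + 1) → T) → (Fin d → Γ) → T) : Bracketing d T Γ → T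
  | leaf x => x
  | node c γ => μ (fun i => (c i).eval μ) γ

end Bracketing

/-- A (not necessarily commutative) `(d + 1)`-ary `Γ`-semiring. -/
class GammaSemiring (d : ℕ) (T : Type u) (Γ : Type v) [AddCommMonoid T] [AddCommSemigroup Γ] where
  /-- the operation `[x₀, …, x_d]_{γ₀, …, γ_{d-1}}` -/
  mul : (Fin (d + 1) → T) → (Fin d → Γ) → T
  mul_add : ∀ (x : Fin (d + 1) → T) (i : Fin (d + 1)) (a b : T) (γ : Fin d → Γ),
    mul (Function.update x i (a + b)) γ =
      mul (Function.update x i a) γ + mul (Function.update x i b) γ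
  mul_zero : ∀ (x : Fin (d + 1) → T) (i : Fin (d + 1)) (γ : Fin d → Γ),
    mul (Function.update x i 0) γ = 0
  /-- associativity: the value of an iterated product depends only on the word -/
  mul_assoc : ∀ b b' : Bracketing d T Γ, b.word = b'.word → b.eval mul = b'.eval mul

/-! ### Positional modules -/

/-- One operation applied to a module element: the action numbered `i`, with the other `d` slots
filled, in order, by the bracketings `x₀, …, x_{d-1}`. -/
structure InsertionStep (d : ℕ) (T : Type u) (Γ : Type v) (ι : Type) where
  i : ι
  x : Fin d → Bracketing d T Γ
  γ : Fin d → Γ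

namespace InsertionStep

variable {d : ℕ} {T : Type u} {Γ : Type v} {ι : Type}

/-- If the module element `m` is inserted into slot `j`, the word of the operation is
`x₀ γ₀ … x_{j-1} γ_{j-1} m γ_j x_j … γ_{d-1} x_{d-1}`; this is the part to the left of `m`. -/
def before (s : ι → Fin (d + 1)) (p : InsertionStep d T Γ ι) : List (T ⊕ Γ) :=
  ((List.finRange d).take (s p.i)).flatMap fun a => (p.x a).word ++ [Sum.inr (p.γ a)]

/-- The part of the word to the right of the module element. -/
def after (s : ι → Fin (d + 1)) (p : InsertionStep d T Γ ι) : List (T ⊕ Γ) :=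
  ((List.finRange d).drop (s p.i)).flatMap fun a => Sum.inr (p.γ a) :: (p.x a).word

end InsertionStep

/-- A bracketing of a word with exactly one letter `m` from a module in which `m` (or the bracket
containing it) always stands in an allowed slot: the list of the nested operations
which contain `m`, the outermost one first. -/
abbrev ModuleBracketing (d : ℕ) (T : Type u) (Γ : Type v) (ι : Type) :=
  List (InsertionStep d T Γ ι)

namespace ModuleBracketing

variable {d : ℕ} {T : Type u} {Γ : Type v} {ι : Type}

/-- The part of the word to the left of the module letter. -/
def before (s : ι → Fin (d + 1)) : ModuleBracketing d T Γ ι → List (T ⊕ Γ)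
  | [] => []
  | p :: c => p.before s ++ before s c

/-- The part of the word to the right of the module letter. -/
def after (s : ι → Fin (d + 1)) : ModuleBracketing d T Γ ι → List (T ⊕ Γ)
  | [] => []
  | p :: c => after s c ++ p.after s

/-- The value of the bracketing with module letter `m`. -/
def eval {M : Type w} (μ : (Fin (d + 1) → T) → (Fin d → Γ) → T)
    (act : ι → (Fin d → T) → (Fin d → Γ) → M → M) : ModuleBracketing d T Γ ι → M → M
  | [], m => m
  | p :: c, m => act p.i (fun a => (p.x a).eval μ) p.γ (eval μ act c m)

end ModuleBracketing

/-- A commutative monoid `M` with compatible positional actions of a `(d + 1)`-ary `Γ`-semiring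
`T`, indexed by `ι`; the action numbered `i` inserts the module element into slot `s i`. -/
class SlotModule {d : ℕ} (T : Type u) (Γ : Type v) [AddCommMonoid T] [AddCommSemigroup Γ]
    [GammaSemiring d T Γ] {ι : Type} (s : ι → Fin (d + 1)) (M : Type w) [AddCommMonoid M] where
  /-- `act i x γ m` is the product with `m` in slot `s i`, with the other slots filled, in order, by
  `x₀, …, x_{d-1}`, and with parameters `γ₀, …, γ_{d-1}` -/
  act : ι → (Fin d → T) → (Fin d → Γ) → M → M
  act_add : ∀ i x γ m m', act i x γ (m + m') = act i x γ m + act i x γ m'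
  act_zero : ∀ i x γ, act i x γ 0 = 0
  add_act : ∀ i x (a : Fin d) (t t' : T) γ m, act i (Function.update x a (t + t')) γ m =
    act i (Function.update x a t) γ m + act i (Function.update x a t') γ m
  zero_act : ∀ i x (a : Fin d) γ m, act i (Function.update x a (0 : T)) γ m = 0
  act_param_add : ∀ i x γ γ' m, act i x (γ + γ') m = act i x γ m + act i x γ' m
  /-- associativity and compatibility: bracketings of the same word have the same value -/
  act_assoc : ∀ c c' : ModuleBracketing d T Γ ι, c.before s = c'.before s →
    c.after s = c'.after s → ∀ m,
      c.eval (GammaSemiring.mul (d := d)) act m = c'.eval (GammaSemiring.mul (d := d)) act m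

/-- The additive category of positional modules: the objects are positional modules whose
underlying additive monoid is an abelian group. -/
structure SlotMod {d : ℕ} (T : Type u) (Γ : Type v) [AddCommMonoid T] [AddCommSemigroup Γ]
    [GammaSemiring d T Γ] {ι : Type} (s : ι → Fin (d + 1)) where
  carrier : Type (max u v)
  [addCommGroup : AddCommGroup carrier]
  [slotModule : SlotModule T Γ s carrier]

namespace SlotMod

open SlotModule

variable {d : ℕ} {T : Type u} {Γ : Type v} [AddCommMonoid T] [AddCommSemigroup Γ]
  [GammaSemiring d T Γ] {ι : Type} {s : ι → Fin (d + 1)}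

attribute [instance] addCommGroup slotModule

instance : CoeSort (SlotMod T Γ s) (Type (max u v)) := ⟨carrier⟩

/-- Morphisms are the additive maps which preserve all the actions. -/
@[ext]
structure Hom (M N : SlotMod T Γ s) where
  hom : M →+ N
  map_act : ∀ (i : ι) (x : Fin d → T) (γ : Fin d → Γ) (m : M),
    hom (act s i x γ m) = act s i x γ (hom m)

instance : Category (SlotMod T Γ s) where
  Hom := Hom
  id M := ⟨AddMonoidHom.id M, fun _ _ _ _ => rfl⟩
  comp f g := ⟨g.hom.comp f.hom, fun i x γ m => by simp [f.map_act, g.map_act]⟩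

variable {M N P : SlotMod T Γ s}

@[ext]
theorem hom_ext {f g : M ⟶ N} (h : f.hom = g.hom) : f = g := Hom.ext h

@[simp] theorem id_hom : Hom.hom (𝟙 M) = AddMonoidHom.id M := rfl

@[simp] theorem comp_hom (f : M ⟶ N) (g : N ⟶ P) : (f ≫ g).hom = g.hom.comp f.hom := rfl

instance : Zero (M ⟶ N) := ⟨⟨0, fun i x γ _ => (act_zero (s := s) i x γ).symm⟩⟩

instance : Add (M ⟶ N) :=
  ⟨fun f g => ⟨f.hom + g.hom, fun i x γ m => by simp [f.map_act, g.map_act, act_add]⟩⟩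

theorem act_neg (i : ι) (x : Fin d → T) (γ : Fin d → Γ) (m : M) :
    act s i x γ (-m) = -act s i x γ m :=
  map_neg (⟨⟨act s i x γ, act_zero i x γ⟩, act_add i x γ⟩ : M →+ M) m

instance : Neg (M ⟶ N) := ⟨fun f => ⟨-f.hom, fun i x γ m => by simp [f.map_act, act_neg]⟩⟩

@[simp] theorem zero_hom : (0 : M ⟶ N).hom = 0 := rfl

@[simp] theorem add_hom (f g : M ⟶ N) : (f + g).hom = f.hom + g.hom := rfl

@[simp] theorem neg_hom (f : M ⟶ N) : (-f).hom = -f.hom := rfl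

/-- Pointwise addition of morphisms. -/
instance : AddCommGroup (M ⟶ N) where
  add_assoc f g h := by ext : 1; simp [add_assoc]
  zero_add f := by ext : 1; simp
  add_zero f := by ext : 1; simp
  add_comm f g := by ext : 1; simp [add_comm]
  neg_add_cancel f := by ext : 1; simp
  nsmul := nsmulRec
  zsmul := zsmulRec

instance : Preadditive (SlotMod T Γ s) where
  add_comp _ _ _ f f' g := by ext m; simp
  comp_add _ _ _ f g g' := by ext m; simp

/-! #### The category of positional modules is abelian with enough projectives and injectives

It is equivalent to the category of modules over a ring with one generator for each
operator `act i x γ`. -/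

/-- The noncommutative polynomials in formal operators `act i x γ`. -/
abbrev FreeOps (d : ℕ) (T : Type u) (Γ : Type v) (ι : Type) : Type (max u v) :=
  FreeAlgebra ℤ (ι × (Fin d → T) × (Fin d → Γ))

/-- The additive endomorphism `act i x γ`. -/
def actHom (M : SlotMod T Γ s) (q : ι × (Fin d → T) × (Fin d → Γ)) : AddMonoid.End M :=
  ⟨⟨act s q.1 q.2.1 q.2.2, act_zero _ _ _⟩, act_add _ _ _⟩

/-- Formal operators act on each positional module. -/
noncomputable def evalOps (M : SlotMod T Γ s) : FreeOps d T Γ ι →ₐ[ℤ] AddMonoid.End M :=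
  FreeAlgebra.lift ℤ (actHom M)

theorem evalOps_ι (M : SlotMod T Γ s) (q : ι × (Fin d → T) × (Fin d → Γ)) :
    evalOps M (FreeAlgebra.ι ℤ q) = actHom M q := by
  simp [evalOps]

theorem evalOps_ι_apply (M : SlotMod T Γ s) (q : ι × (Fin d → T) × (Fin d → Γ)) (m : M) :
    evalOps M (FreeAlgebra.ι ℤ q) m = act s q.1 q.2.1 q.2.2 m := by
  rw [evalOps_ι]; rfl

theorem evalOps_mul_apply (M : SlotMod T Γ s) (a b : FreeOps d T Γ ι) (m : M) :
    evalOps M (a * b) m = evalOps M a (evalOps M b m) := by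
  rw [map_mul]; rfl

theorem evalOps_add_apply (M : SlotMod T Γ s) (a b : FreeOps d T Γ ι) (m : M) :
    evalOps M (a + b) m = evalOps M a m + evalOps M b m := by
  rw [map_add]; rfl

/-- Two formal operators are identified if they agree on all positional modules. -/
def OpsRel (s : ι → Fin (d + 1)) (a b : FreeOps d T Γ ι) : Prop :=
  ∀ M : SlotMod.{u, v} T Γ s, evalOps M a = evalOps M b

variable (T Γ s) in
/-- The enveloping ring. -/
abbrev Env : Type (max u v) := RingQuot (OpsRel (T := T) (Γ := Γ) s)

/-- The enveloping ring acts on each positional module. -/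
noncomputable def evalEnv (M : SlotMod T Γ s) : Env T Γ s →+* AddMonoid.End M :=
  RingQuot.lift ⟨(evalOps M : FreeOps d T Γ ι →+* AddMonoid.End M), fun _ _ h => h M⟩

variable (s) in
/-- The class of a formal operator in the enveloping ring. -/
noncomputable def opsMk : FreeOps d T Γ ι →+* Env T Γ s := RingQuot.mkRingHom _

@[simp] theorem evalEnv_opsMk (M : SlotMod T Γ s) (a : FreeOps d T Γ ι) :
    evalEnv M (opsMk s a) = evalOps M a :=
  RingQuot.lift_mkRingHom_apply _ _ _

theorem opsMk_eq {a b : FreeOps d T Γ ι} (h : ∀ M : SlotMod.{u, v} T Γ s,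
    evalOps M a = evalOps M b) : opsMk s a = opsMk s b :=
  RingQuot.mkRingHom_rel h

/-- The module over the enveloping ring attached to a positional module. -/
noncomputable abbrev envModule (M : SlotMod T Γ s) : Module (Env T Γ s) M :=
  Module.compHom M (evalEnv M)

theorem envModule_smul (M : SlotMod T Γ s) (r : Env T Γ s) (m : M) :
    letI := envModule M
    r • m = evalEnv M r m := rfl

theorem hom_evalOps (f : M ⟶ N) (a : FreeOps d T Γ ι) (m : M) :
    f.hom (evalOps M a m) = evalOps N a (f.hom m) := by
  induction a using FreeAlgebra.induction generalizing m with
  | grade0 z => simp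
  | grade1 q => simpa only [evalOps_ι_apply] using f.map_act q.1 q.2.1 q.2.2 m
  | mul a b ha hb => simp only [evalOps_mul_apply, ha, hb]
  | add a b ha hb => rw [evalOps_add_apply, evalOps_add_apply, map_add, ha, hb]

variable (T Γ s) in
/-- The comparison with modules over the enveloping ring. -/
noncomputable def toEnv : SlotMod T Γ s ⥤ ModuleCat.{max u v} (Env T Γ s) where
  obj M := letI := envModule M; ModuleCat.of (Env T Γ s) M
  map {M N} f := letI := envModule M; letI := envModule N
    ModuleCat.ofHom
      { toFun := f.hom
        map_add' := f.hom.map_add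
        map_smul' := fun r m => by
          obtain ⟨a, rfl⟩ := RingQuot.mkRingHom_surjective _ r
          change f.hom (evalEnv M (opsMk s a) m) = evalEnv N (opsMk s a) (f.hom m)
          simp [hom_evalOps] }

instance : (toEnv T Γ s).Faithful where
  map_injective {M N f g} h := by
    ext m
    exact congrArg (fun φ => φ.hom m) h

instance : (toEnv T Γ s).Full where
  map_surjective {M N} g := by
    refine ⟨⟨⟨⟨fun m => g.hom m, map_zero g.hom⟩, map_add g.hom⟩, fun i x γ m => ?_⟩, rfl⟩
    have h := g.hom.map_smul (opsMk s (FreeAlgebra.ι ℤ (i, x, γ))) m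
    change g.hom (evalEnv M (opsMk s (FreeAlgebra.ι ℤ (i, x, γ))) m) =
      evalEnv N (opsMk s (FreeAlgebra.ι ℤ (i, x, γ))) (g.hom m) at h
    rw [evalEnv_opsMk, evalEnv_opsMk, evalOps_ι, evalOps_ι] at h
    exact h

/-- The formal operator given by a bracketing. -/
noncomputable def bracketOp : ModuleBracketing d T Γ ι → FreeOps d T Γ ι
  | [] => 1
  | p :: c => FreeAlgebra.ι ℤ (p.i, (fun a => (p.x a).eval GammaSemiring.mul), p.γ) * bracketOp c

theorem evalOps_bracketOp (M : SlotMod T Γ s) (c : ModuleBracketing d T Γ ι) (m : M) :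
    evalOps M (bracketOp c) m = c.eval (GammaSemiring.mul (d := d)) (act s) m := by
  induction c with
  | nil => simp [bracketOp, ModuleBracketing.eval]
  | cons p c ih => rw [bracketOp, evalOps_mul_apply, evalOps_ι_apply, ih]; rfl

/-- The positional module attached to a module over the enveloping ring. -/
noncomputable abbrev ofEnvModule (X : Type (max u v)) [AddCommGroup X] [Module (Env T Γ s) X] :
    SlotModule T Γ s X where
  act i x γ m := opsMk s (FreeAlgebra.ι ℤ (i, x, γ)) • m
  act_add _ _ _ _ _ := smul_add _ _ _
  act_zero _ _ _ := smul_zero _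
  add_act i x a t t' γ m := by
    rw [← add_smul, ← map_add]
    refine congrArg (· • m) (opsMk_eq fun M => ?_)
    ext y
    rw [evalOps_add_apply, evalOps_ι_apply, evalOps_ι_apply, evalOps_ι_apply]
    exact add_act (s := s) i x a t t' γ y
  zero_act i x a γ m := by
    rw [← zero_smul (Env T Γ s) m, ← map_zero (opsMk s)]
    refine congrArg (· • m) (opsMk_eq fun M => ?_)
    ext y
    rw [map_zero, evalOps_ι_apply]
    exact zero_act (s := s) i x a γ y
  act_param_add i x γ γ' m := by
    rw [← add_smul, ← map_add]
    refine congrArg (· • m) (opsMk_eq fun M => ?_)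
    ext y
    rw [evalOps_add_apply, evalOps_ι_apply, evalOps_ι_apply, evalOps_ι_apply]
    exact act_param_add (s := s) i x γ γ' y
  act_assoc c c' h h' m := by
    have key : ∀ c : ModuleBracketing d T Γ ι, c.eval (GammaSemiring.mul (d := d))
        (fun i x γ (m : X) => opsMk s (FreeAlgebra.ι ℤ (i, x, γ)) • m) m =
          opsMk s (bracketOp c) • m := by
      intro c
      induction c with
      | nil => simp [bracketOp, ModuleBracketing.eval]
      | cons p c ih => simp [bracketOp, ModuleBracketing.eval, ih, mul_smul]
    rw [key, key]
    refine congrArg (· • m) (opsMk_eq fun M => ?_)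
    ext y
    rw [evalOps_bracketOp, evalOps_bracketOp]
    exact act_assoc c c' h h' y

theorem evalOps_ofEnvModule (X : Type (max u v)) [AddCommGroup X] [Module (Env T Γ s) X]
    (a : FreeOps d T Γ ι) (m : X) :
    evalOps (s := s) { carrier := X, slotModule := ofEnvModule X } a m = opsMk s a • m := by
  induction a using FreeAlgebra.induction generalizing m with
  | grade0 z =>
    rw [eq_intCast, map_intCast, map_intCast, Int.cast_smul_eq_zsmul]
    rfl
  | grade1 q => rw [evalOps_ι_apply]; rfl
  | mul a b ha hb => rw [map_mul (opsMk s), mul_smul, evalOps_mul_apply, hb]; exact ha _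
  | add a b ha hb => rw [map_add (opsMk s), add_smul, evalOps_add_apply, hb, ha]

instance : (toEnv T Γ s).EssSurj where
  mem_essImage X := by
    let Y : SlotMod T Γ s := { carrier := X, slotModule := ofEnvModule X }
    let e : (toEnv T Γ s).obj Y ≃ₗ[Env T Γ s] X :=
      { toFun := fun m => m
        invFun := fun m => m
        left_inv := fun _ => rfl
        right_inv := fun _ => rfl
        map_add' := fun _ _ => rfl
        map_smul' := fun r m => by
          obtain ⟨a, rfl⟩ := RingQuot.mkRingHom_surjective _ r
          refine Eq.trans ?_ (evalOps_ofEnvModule X a m)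
          change evalEnv Y (opsMk s a) m = evalOps Y a m
          rw [evalEnv_opsMk] }
    exact ⟨Y, ⟨e.toModuleIso⟩⟩

instance : (toEnv T Γ s).IsEquivalence where

instance : (toEnv T Γ s).Additive where

instance : HasFiniteProducts (SlotMod T Γ s) where
  out _ := Adjunction.hasLimitsOfShape_of_equivalence (toEnv T Γ s)

noncomputable instance : Abelian (SlotMod T Γ s) := abelianOfEquivalence (toEnv T Γ s)

instance : EnoughProjectives (SlotMod T Γ s) :=
  ((toEnv T Γ s).asEquivalence.enoughProjectives_iff).2 inferInstance

instance : EnoughInjectives (SlotMod T Γ s) := EnoughInjectives.of_equivalence (toEnv T Γ s)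

end SlotMod

/-! ### Left, right and bi-modules -/

/-- The two actions of a bi-module. -/
inductive Side
  | left
  | right

/-- The slots of the two actions of a bi-module. -/
def Side.slot {d : ℕ} (j k : Fin (d + 1)) : Side → Fin (d + 1)
  | left => j
  | right => k

section

variable {d : ℕ} (T : Type u) (Γ : Type v) [AddCommMonoid T] [AddCommSemigroup Γ]
  [GammaSemiring d T Γ]

/-- Left `Γ`-modules, with module slot `j`. -/
abbrev LeftMod (j : Fin (d + 1)) := SlotMod T Γ (fun _ : Unit => j)

/-- Right `Γ`-modules, with module slot `k`. -/
abbrev RightMod (k : Fin (d + 1)) := SlotMod T Γ (fun _ : Unit => k)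

/-- Bi-`Γ`-modules, with a left action in slot `j` and a compatible right action in slot `k`. -/
abbrev BiMod (j k : Fin (d + 1)) := SlotMod T Γ (Side.slot j k)

end

namespace SlotMod

open SlotModule

variable {d : ℕ} {T : Type u} {Γ : Type v} [AddCommMonoid T] [AddCommSemigroup Γ]
  [GammaSemiring d T Γ]

section Restrict

variable {ι : Type} {s : ι → Fin (d + 1)}

theorem eval_single (M : SlotMod T Γ s) (i : ι) (c : ModuleBracketing d T Γ Unit) :
    ∃ c' : ModuleBracketing d T Γ ι, c'.before s = c.before (fun _ => s i) ∧
      c'.after s = c.after (fun _ => s i) ∧ ∀ m : M,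
        c'.eval (GammaSemiring.mul (d := d)) (act s) m =
          c.eval (GammaSemiring.mul (d := d)) (fun _ => act s i) m := by
  induction c with
  | nil => exact ⟨[], rfl, rfl, fun _ => rfl⟩
  | cons p c ih =>
    obtain ⟨c', h₁, h₂, h₃⟩ := ih
    refine ⟨⟨i, p.x, p.γ⟩ :: c', ?_, ?_, fun m => ?_⟩
    · simp only [ModuleBracketing.before, h₁]; rfl
    · simp only [ModuleBracketing.after, h₂]; rfl
    · simp only [ModuleBracketing.eval, h₃]

/-- Keep only the action numbered `i`. -/
def single (i : ι) : SlotMod T Γ s ⥤ SlotMod T Γ (fun _ : Unit => s i) where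
  obj M :=
    { carrier := M
      slotModule :=
        { act := fun _ => act s i
          act_add := fun _ => act_add i
          act_zero := fun _ => act_zero i
          add_act := fun _ => add_act i
          zero_act := fun _ => zero_act i
          act_param_add := fun _ => act_param_add i
          act_assoc := fun c c' h h' m => by
            obtain ⟨b, h₁, h₂, h₃⟩ := eval_single M i c
            obtain ⟨b', h₁', h₂', h₃'⟩ := eval_single M i c'
            rw [← h₃, ← h₃']
            exact act_assoc b b' (by rw [h₁, h₁', h]) (by rw [h₂, h₂', h']) m } }
  map f := ⟨f.hom, fun _ => f.map_act i⟩

end Restrict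

variable {j k : Fin (d + 1)}

/-- The left module underlying a bi-module. -/
def toLeft : BiMod T Γ j k ⥤ LeftMod T Γ j := single Side.left

/-- The right module underlying a bi-module. -/
def toRight : BiMod T Γ j k ⥤ RightMod T Γ k := single Side.right

instance : (toLeft : BiMod T Γ j k ⥤ LeftMod T Γ j).Additive where

instance : (toRight : BiMod T Γ j k ⥤ RightMod T Γ k).Additive where

/-! ### The positional tensor product -/

/-- The relations `μ⁽ʲ⁾(a; m; γ) ⊗ n ∼ m ⊗ μ⁽ᵏ⁾(a; n; γ)`. -/
def balancing (M : LeftMod T Γ j) (N : RightMod T Γ k) : AddSubgroup (M ⊗[ℤ] N) :=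
  AddSubgroup.closure {t | ∃ (a : Fin d → T) (γ : Fin d → Γ) (m : M) (n : N),
    t = act (fun _ => j) () a γ m ⊗ₜ[ℤ] n - m ⊗ₜ[ℤ] act (fun _ => k) () a γ n}

/-- The positional tensor product: the coequalizer, in abelian groups, of the two maps
`(a, γ, m ⊗ n) ↦ μ⁽ʲ⁾(a; m; γ) ⊗ n` and `(a, γ, m ⊗ n) ↦ m ⊗ μ⁽ᵏ⁾(a; n; γ)`. -/
abbrev PosTensor (M : LeftMod T Γ j) (N : RightMod T Γ k) : Type (max u v) :=
  (M ⊗[ℤ] N) ⧸ balancing M N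

/-- Functoriality of the positional tensor product. -/
noncomputable def posTensorMap {M M' : LeftMod T Γ j} {N N' : RightMod T Γ k} (f : M ⟶ M')
    (g : N ⟶ N') : PosTensor M N →+ PosTensor M' N' :=
  QuotientAddGroup.map _ _
    (TensorProduct.map f.hom.toIntLinearMap g.hom.toIntLinearMap).toAddMonoidHom (by
      rw [balancing, AddSubgroup.closure_le]
      rintro _ ⟨a, γ, m, n, rfl⟩
      refine AddSubgroup.subset_closure ⟨a, γ, f.hom m, g.hom n, ?_⟩
      simp [f.map_act, g.map_act])

theorem posTensor_hom_ext {M : LeftMod T Γ j} {N : RightMod T Γ k} {A : Type*} [AddCommGroup A]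
    {f g : PosTensor M N →+ A} (h : ∀ (m : M) (n : N), f (QuotientAddGroup.mk (m ⊗ₜ[ℤ] n)) =
      g (QuotientAddGroup.mk (m ⊗ₜ[ℤ] n))) : f = g := by
  refine QuotientAddGroup.addMonoidHom_ext _ ?_
  ext t
  induction t with
  | zero => simp
  | tmul m n => exact h m n
  | add x y hx hy => rw [map_add, map_add, hx, hy]

@[simp] theorem posTensorMap_mk {M M' : LeftMod T Γ j} {N N' : RightMod T Γ k} (f : M ⟶ M')
    (g : N ⟶ N') (m : M) (n : N) : posTensorMap f g (QuotientAddGroup.mk (m ⊗ₜ[ℤ] n)) =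
      QuotientAddGroup.mk (f.hom m ⊗ₜ[ℤ] g.hom n) := rfl

/-- The bifunctor `(M, N) ↦ M ⊗⁽ʲᵏ⁾ N` as a functor of `M`. -/
noncomputable def tensorRight (N : RightMod T Γ k) : LeftMod T Γ j ⥤ AddCommGrpCat.{max u v} where
  obj M := AddCommGrpCat.of (PosTensor M N)
  map f := AddCommGrpCat.ofHom (posTensorMap f (𝟙 N))
  map_id M := by ext : 1; exact posTensor_hom_ext fun m n => rfl
  map_comp f g := by ext : 1; exact posTensor_hom_ext fun m n => rfl

/-- The bifunctor `(M, N) ↦ M ⊗⁽ʲᵏ⁾ N` as a functor of `N`. -/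
noncomputable def tensorLeft (M : LeftMod T Γ j) : RightMod T Γ k ⥤ AddCommGrpCat.{max u v} where
  obj N := AddCommGrpCat.of (PosTensor M N)
  map g := AddCommGrpCat.ofHom (posTensorMap (𝟙 M) g)
  map_id N := by ext : 1; exact posTensor_hom_ext fun m n => rfl
  map_comp f g := by ext : 1; exact posTensor_hom_ext fun m n => rfl

instance (N : RightMod T Γ k) :
    (tensorRight N : LeftMod T Γ j ⥤ AddCommGrpCat.{max u v}).Additive where
  map_add {M M' f g} := by
    ext : 1
    refine posTensor_hom_ext fun m n => ?_
    change QuotientAddGroup.mk ((f.hom m + g.hom m) ⊗ₜ[ℤ] n) = _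
    rw [TensorProduct.add_tmul]
    rfl

instance (M : LeftMod T Γ j) :
    (tensorLeft M : RightMod T Γ k ⥤ AddCommGrpCat.{max u v}).Additive where
  map_add {N N' f g} := by
    ext : 1
    refine posTensor_hom_ext fun m n => ?_
    change QuotientAddGroup.mk (m ⊗ₜ[ℤ] (f.hom n + g.hom n)) = _
    rw [TensorProduct.tmul_add]
    rfl

/-! ### Derived functors on bi-modules -/

/-- `Hom⁽ʲᵏ⁾(M, -)`: the additive group of the maps which respect both actions. -/
noncomputable abbrev homFrom (M : BiMod T Γ j k) : BiMod T Γ j k ⥤ AddCommGrpCat.{max u v} :=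
  preadditiveCoyoneda.obj (Opposite.op M)

/-- `- ⊗⁽ʲᵏ⁾ N` on bi-modules, through their left action. -/
noncomputable abbrev biTensorRight (N : RightMod T Γ k) :
    BiMod T Γ j k ⥤ AddCommGrpCat.{max u v} :=
  toLeft ⋙ tensorRight N

/-- `M ⊗⁽ʲᵏ⁾ -` on bi-modules, through their right action. -/
noncomputable abbrev biTensorLeft (M : LeftMod T Γ j) :
    BiMod T Γ j k ⥤ AddCommGrpCat.{max u v} :=
  toRight ⋙ tensorLeft M

/-- `Ext⁽ʲᵏ⁾` in degree `r`: the bifunctor whose value at `M` is the `r`-th right derived functor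
of `Hom⁽ʲᵏ⁾(M, -)`. -/
noncomputable def extFunctor (T : Type u) (Γ : Type v) [AddCommMonoid T] [AddCommSemigroup Γ]
    [GammaSemiring d T Γ] (j k : Fin (d + 1)) (r : ℕ) :
    (BiMod T Γ j k)ᵒᵖ ⥤ BiMod T Γ j k ⥤ AddCommGrpCat.{max u v} where
  obj M := (homFrom M.unop).rightDerived r
  map f := NatTrans.rightDerived (preadditiveCoyoneda.map f) r
  map_id M := by rw [CategoryTheory.Functor.map_id]; exact NatTrans.rightDerived_id _ r
  map_comp f g := by rw [CategoryTheory.Functor.map_comp]; exact NatTrans.rightDerived_comp _ _ r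

/-- `Tor⁽ʲᵏ⁾(-, N)` in degree `r`: the left derived functor of `- ⊗⁽ʲᵏ⁾ N`. -/
noncomputable def torRight (j : Fin (d + 1)) (N : RightMod T Γ k) (r : ℕ) :
    BiMod T Γ j k ⥤ AddCommGrpCat.{max u v} :=
  (biTensorRight N).leftDerived r

/-- `Tor⁽ʲᵏ⁾(M, -)` in degree `r`: the left derived functor of `M ⊗⁽ʲᵏ⁾ -`. -/
noncomputable def torLeft (k : Fin (d + 1)) (M : LeftMod T Γ j) (r : ℕ) :
    BiMod T Γ j k ⥤ AddCommGrpCat.{max u v} :=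
  (biTensorLeft M).leftDerived r

end SlotMod

/-! ### Long exact sequences -/

section LongExact

variable {C : Type u} [Category.{v} C] [Abelian C]

/-- Natural long exact sequences
`0 → E⁰(A) → E⁰(B) → E⁰(C) → E¹(A) → E¹(B) → E¹(C) → E²(A) → …`
for all short exact sequences `0 → A → B → C → 0`. -/
structure CohomologicalSequences (E : ℕ → C ⥤ AddCommGrpCat.{w}) where
  δ : ∀ S : ShortComplex C, S.ShortExact → ∀ r : ℕ, (E r).obj S.X₃ ⟶ (E (r + 1)).obj S.X₁
  naturality : ∀ (S S' : ShortComplex C) (hS : S.ShortExact) (hS' : S'.ShortExact) (φ : S ⟶ S')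
    (r : ℕ), δ S hS r ≫ (E (r + 1)).map φ.τ₁ = (E r).map φ.τ₃ ≫ δ S' hS' r
  injective : ∀ S : ShortComplex C, S.ShortExact → Function.Injective ((E 0).map S.f)
  exact_middle : ∀ S : ShortComplex C, S.ShortExact → ∀ r,
    Function.Exact ((E r).map S.f) ((E r).map S.g)
  exact_right : ∀ (S : ShortComplex C) (hS : S.ShortExact) (r : ℕ),
    Function.Exact ((E r).map S.g) (δ S hS r)
  exact_left : ∀ (S : ShortComplex C) (hS : S.ShortExact) (r : ℕ),
    Function.Exact (δ S hS r) ((E (r + 1)).map S.f)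

/-- Natural long exact sequences
`0 → E⁰(C) → E⁰(B) → E⁰(A) → E¹(C) → E¹(B) → E¹(A) → E²(C) → …`
for all short exact sequences `0 → A → B → C → 0`. -/
structure ContravariantSequences (E : ℕ → Cᵒᵖ ⥤ AddCommGrpCat.{w}) where
  δ : ∀ S : ShortComplex C, S.ShortExact → ∀ r : ℕ,
    (E r).obj (Opposite.op S.X₁) ⟶ (E (r + 1)).obj (Opposite.op S.X₃)
  naturality : ∀ (S S' : ShortComplex C) (hS : S.ShortExact) (hS' : S'.ShortExact) (φ : S ⟶ S')
    (r : ℕ), δ S' hS' r ≫ (E (r + 1)).map φ.τ₃.op = (E r).map φ.τ₁.op ≫ δ S hS r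
  injective : ∀ S : ShortComplex C, S.ShortExact → Function.Injective ((E 0).map S.g.op)
  exact_middle : ∀ S : ShortComplex C, S.ShortExact → ∀ r,
    Function.Exact ((E r).map S.g.op) ((E r).map S.f.op)
  exact_left : ∀ (S : ShortComplex C) (hS : S.ShortExact) (r : ℕ),
    Function.Exact ((E r).map S.f.op) (δ S hS r)
  exact_right : ∀ (S : ShortComplex C) (hS : S.ShortExact) (r : ℕ),
    Function.Exact (δ S hS r) ((E (r + 1)).map S.g.op)

/-- Natural long exact sequences
`… → E₂(C) → E₁(A) → E₁(B) → E₁(C) → E₀(A) → E₀(B) → E₀(C) → 0`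
for all short exact sequences `0 → A → B → C → 0`. -/
structure HomologicalSequences (E : ℕ → C ⥤ AddCommGrpCat.{w}) where
  δ : ∀ S : ShortComplex C, S.ShortExact → ∀ r : ℕ, (E (r + 1)).obj S.X₃ ⟶ (E r).obj S.X₁
  naturality : ∀ (S S' : ShortComplex C) (hS : S.ShortExact) (hS' : S'.ShortExact) (φ : S ⟶ S')
    (r : ℕ), δ S hS r ≫ (E r).map φ.τ₁ = (E (r + 1)).map φ.τ₃ ≫ δ S' hS' r
  surjective : ∀ S : ShortComplex C, S.ShortExact → Function.Surjective ((E 0).map S.g)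
  exact_middle : ∀ S : ShortComplex C, S.ShortExact → ∀ r,
    Function.Exact ((E r).map S.f) ((E r).map S.g)
  exact_right : ∀ (S : ShortComplex C) (hS : S.ShortExact) (r : ℕ),
    Function.Exact ((E (r + 1)).map S.g) (δ S hS r)
  exact_left : ∀ (S : ShortComplex C) (hS : S.ShortExact) (r : ℕ),
    Function.Exact (δ S hS r) ((E r).map S.f)

end LongExact

/-! ### Projective and injective objects in the category of short complexes. -/

namespace CategoryTheory.ShortComplex

open scoped ZeroObject

variable {C : Type u} [Category.{v} C] [Abelian C]

/-! In degree zero the claim is one-sided exactness. The functor `homFrom M` is left exact. The two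
tensor functors are right exact because `⊗` over `ℤ` is, and because every balancing relation lifts
along a surjection (`exists_mem_balancing_left`, `exists_mem_balancing_right`).

For the sequences 1, 3 and 4, the horseshoe lemma is replaced by homological algebra in the abelian
category of short complexes, which inherits enough projectives and enough injectives from the base.
A projective short complex has projective first and second terms and a split monomorphism between
them. Hence a projective resolution of `S` in this category yields resolutions of `S.X₁` and `S.X₂`
and a degreewise split monomorphism between them. Its cokernel resolves `S.X₃` when `S` is short
exact, by the five lemma. The third terms of the resolution are not used: the projective `0 ⟶ 0 ⟶ X`
shows that they need not be this cokernel. The resulting sequence of complexes splits in each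
degree, so every additive functor keeps it short exact, and its homology gives the long exact
sequence. A morphism of short exact sequences lifts to a single chain map of resolutions in the
category of short complexes, so all squares commute strictly and naturality of the connecting maps
follows. The injective side is dual, with the kernel of the second map.

Sequence 2 needs only one injective resolution of `N`: in each degree, `Hom` into an injective
object is exact, so `ShortExact.homTo` provides the short exact sequence of complexes. -/

theorem epi_of_epi_τ {S T : ShortComplex C} (φ : S ⟶ T) [Epi φ.τ₁] [Epi φ.τ₂] [Epi φ.τ₃] :
    Epi φ where
  left_cancellation a b h := by
    ext
    · exact (cancel_epi φ.τ₁).1 (congrArg Hom.τ₁ h)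
    · exact (cancel_epi φ.τ₂).1 (congrArg Hom.τ₂ h)
    · exact (cancel_epi φ.τ₃).1 (congrArg Hom.τ₃ h)

theorem mono_of_mono_τ {S T : ShortComplex C} (φ : S ⟶ T) [Mono φ.τ₁] [Mono φ.τ₂]
    [Mono φ.τ₃] : Mono φ where
  right_cancellation a b h := by
    ext
    · exact (cancel_mono φ.τ₁).1 (congrArg Hom.τ₁ h)
    · exact (cancel_mono φ.τ₂).1 (congrArg Hom.τ₂ h)
    · exact (cancel_mono φ.τ₃).1 (congrArg Hom.τ₃ h)

/-- The short complex `X ⟶ 0 ⟶ 0`. -/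
noncomputable abbrev inLeft (X : C) : ShortComplex C :=
  ShortComplex.mk (0 : X ⟶ 0) (0 : (0 : C) ⟶ 0) (by simp)

/-- The short complex `X ⟶ X ⟶ 0`. -/
noncomputable abbrev inLeftMid (X : C) : ShortComplex C :=
  ShortComplex.mk (𝟙 X) (0 : X ⟶ 0) (by simp)

/-- The short complex `0 ⟶ X ⟶ X`. -/
noncomputable abbrev inMidRight (X : C) : ShortComplex C :=
  ShortComplex.mk (0 : 0 ⟶ X) (𝟙 X) (by simp)

/-- The short complex `0 ⟶ 0 ⟶ X`. -/
noncomputable abbrev inRight (X : C) : ShortComplex C :=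
  ShortComplex.mk (0 : (0 : C) ⟶ 0) (0 : 0 ⟶ X) (by simp)

section Projective

/-- `π₁` is left adjoint to `inLeft`, which preserves epimorphisms; a lifting problem for `P.X₁`
becomes one for `P`. -/
instance projective_X₁ (P : ShortComplex C) [Projective P] : Projective P.X₁ where
  factors {E X} f e _ := by
    let p : inLeft E ⟶ inLeft X := { τ₁ := e, τ₂ := 0, τ₃ := 0 }
    let q : P ⟶ inLeft X :=
      { τ₁ := f, τ₂ := 0, τ₃ := 0 }
    have : Epi p.τ₁ := inferInstanceAs (Epi e)
    have : Epi p.τ₂ := inferInstanceAs (Epi (0 : (0 : C) ⟶ 0))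
    have : Epi p.τ₃ := inferInstanceAs (Epi (0 : (0 : C) ⟶ 0))
    have := epi_of_epi_τ p
    exact ⟨(Projective.factorThru q p).τ₁, congrArg Hom.τ₁ (Projective.factorThru_comp q p)⟩

/-- The same argument, with `inLeftMid` as right adjoint of `π₂`. -/
instance projective_X₂ (P : ShortComplex C) [Projective P] : Projective P.X₂ where
  factors {E X} f e _ := by
    let p : inLeftMid E ⟶ inLeftMid X := { τ₁ := e, τ₂ := e, τ₃ := 0 }
    let q : P ⟶ inLeftMid X :=
      { τ₁ := P.f ≫ f, τ₂ := f, τ₃ := 0 }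
    have : Epi p.τ₁ := inferInstanceAs (Epi e)
    have : Epi p.τ₂ := inferInstanceAs (Epi e)
    have : Epi p.τ₃ := inferInstanceAs (Epi (0 : (0 : C) ⟶ 0))
    have := epi_of_epi_τ p
    exact ⟨(Projective.factorThru q p).τ₂, congrArg Hom.τ₂ (Projective.factorThru_comp q p)⟩

/-- Lift the map `P ⟶ inLeft P.X₁` given by the identity along the epimorphism from `inLeftMid
P.X₁`. The middle component of the lift is a retraction of `P.f`. -/
instance isSplitMono_f_of_projective (P : ShortComplex C) [Projective P] : IsSplitMono P.f := by
  let p : inLeftMid P.X₁ ⟶ inLeft P.X₁ := { τ₁ := 𝟙 _, τ₂ := 0, τ₃ := 0 }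
  let q : P ⟶ inLeft P.X₁ :=
    { τ₁ := 𝟙 _, τ₂ := 0, τ₃ := 0 }
  have : Epi p.τ₁ := inferInstanceAs (Epi (𝟙 _))
  have : Epi p.τ₂ := (isZero_zero C).epi _
  have : Epi p.τ₃ := (isZero_zero C).epi _
  have := epi_of_epi_τ p
  let l := Projective.factorThru q p
  have h₁ : l.τ₁ ≫ 𝟙 P.X₁ = 𝟙 P.X₁ := congrArg Hom.τ₁ (Projective.factorThru_comp q p)
  exact ⟨⟨l.τ₂, l.comm₁₂.symm.trans h₁⟩⟩

theorem Splitting.projective_X₃ {S : ShortComplex C} (s : S.Splitting) [Projective S.X₂] :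
    Projective S.X₃ :=
  Retract.projective ⟨s.s, S.g, s.s_g⟩

/-- As `P.f` splits, its cokernel is a direct summand of the projective object `P.X₂`. -/
theorem projective_cokernel_f (P : ShortComplex C) [Projective P] :
    Projective (cokernel P.f) :=
  have : Projective (ShortComplex.mk P.f (cokernel.π P.f) (by simp)).X₂ := projective_X₂ P
  (Splitting.ofExactOfRetraction (ShortComplex.mk P.f (cokernel.π P.f) (cokernel.condition _))
    (ShortComplex.exact_cokernel P.f) (retraction P.f) (by exact IsSplitMono.id P.f)
    (by dsimp; infer_instance)).projective_X₃

/-- `inLeftMid` is also left adjoint to `π₁`, which preserves epimorphisms. The next two instances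
use in the same way that `inMidRight` and `inRight` are left adjoint to `π₂` and `π₃`. -/
instance (X : C) [Projective X] : Projective (inLeftMid X) where
  factors {E Y} f e _ := by
    have : Epi e.τ₁ := inferInstanceAs (Epi (π₁.map e))
    refine ⟨{ τ₁ := Projective.factorThru f.τ₁ e.τ₁
              τ₂ := Projective.factorThru f.τ₁ e.τ₁ ≫ E.f, τ₃ := 0 }, ?_⟩
    ext
    · simp
    · simpa [← e.comm₁₂] using f.comm₁₂

instance (X : C) [Projective X] : Projective (inMidRight X) where
  factors {E Y} f e _ := by
    have : Epi e.τ₂ := inferInstanceAs (Epi (π₂.map e))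
    refine ⟨{ τ₁ := 0, τ₂ := Projective.factorThru f.τ₂ e.τ₂
              τ₃ := Projective.factorThru f.τ₂ e.τ₂ ≫ E.g }, ?_⟩
    ext
    · simp
    · simpa [← e.comm₂₃] using f.comm₂₃

instance (X : C) [Projective X] : Projective (inRight X) where
  factors {E Y} f e _ := by
    have : Epi e.τ₃ := inferInstanceAs (Epi (π₃.map e))
    refine ⟨{ τ₁ := 0, τ₂ := 0, τ₃ := Projective.factorThru f.τ₃ e.τ₃ }, ?_⟩
    ext
    · simp

instance enoughProjectives [EnoughProjectives C] : EnoughProjectives (ShortComplex C) where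
  presentation S := by
    -- The three summands `a`, `b`, `c` cover the first, second and third terms of `S`, so their sum
    -- is epi in each component.
    let a : inLeftMid (Projective.over S.X₁) ⟶ S :=
      { τ₁ := Projective.π _, τ₂ := Projective.π _ ≫ S.f, τ₃ := 0 }
    let b : inMidRight (Projective.over S.X₂) ⟶ S :=
      { τ₁ := 0, τ₂ := Projective.π _, τ₃ := Projective.π _ ≫ S.g }
    let c : inRight (Projective.over S.X₃) ⟶ S :=
      { τ₁ := 0, τ₂ := 0, τ₃ := Projective.π _ }
    let p := biprod.desc a (biprod.desc b c)
    have h₁ : biprod.inl ≫ p = a := by simp [p]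
    have h₂ : biprod.inl ≫ biprod.inr ≫ p = b := by simp [p]
    have h₃ : biprod.inr ≫ biprod.inr ≫ p = c := by simp [p]
    have : Epi a.τ₁ := inferInstanceAs (Epi (Projective.π S.X₁))
    have : Epi b.τ₂ := inferInstanceAs (Epi (Projective.π S.X₂))
    have : Epi c.τ₃ := inferInstanceAs (Epi (Projective.π S.X₃))
    have : Epi p.τ₁ := epi_of_epi_fac (congrArg Hom.τ₁ h₁)
    have : Epi (biprod.inr ≫ p).τ₂ := epi_of_epi_fac (congrArg Hom.τ₂ h₂)
    have : Epi p.τ₂ := epi_of_epi_fac (comp_τ₂ biprod.inr p).symm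
    have : Epi (biprod.inr ≫ p).τ₃ := epi_of_epi_fac (congrArg Hom.τ₃ h₃)
    have : Epi p.τ₃ := epi_of_epi_fac (comp_τ₃ biprod.inr p).symm
    have := epi_of_epi_τ p
    exact ⟨⟨_, p⟩⟩

end Projective

section Injective

/-- `π₃` is right adjoint to `inRight`, which preserves monomorphisms; for the second term the left
adjoint is `inMidRight`. -/
instance injective_X₃ (I : ShortComplex C) [Injective I] : Injective I.X₃ where
  factors {X E} f e _ := by
    let p : inRight X ⟶ inRight E := { τ₁ := 0, τ₂ := 0, τ₃ := e }
    let q : inRight X ⟶ I :=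
      { τ₁ := 0, τ₂ := 0, τ₃ := f }
    have : Mono p.τ₁ := inferInstanceAs (Mono (0 : (0 : C) ⟶ 0))
    have : Mono p.τ₂ := inferInstanceAs (Mono (0 : (0 : C) ⟶ 0))
    have : Mono p.τ₃ := inferInstanceAs (Mono e)
    have := mono_of_mono_τ p
    exact ⟨(Injective.factorThru q p).τ₃, congrArg Hom.τ₃ (Injective.comp_factorThru q p)⟩

instance injective_X₂ (I : ShortComplex C) [Injective I] : Injective I.X₂ where
  factors {X E} f e _ := by
    let p : inMidRight X ⟶ inMidRight E := { τ₁ := 0, τ₂ := e, τ₃ := e }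
    let q : inMidRight X ⟶ I :=
      { τ₁ := 0, τ₂ := f, τ₃ := f ≫ I.g }
    have : Mono p.τ₁ := inferInstanceAs (Mono (0 : (0 : C) ⟶ 0))
    have : Mono p.τ₂ := inferInstanceAs (Mono e)
    have : Mono p.τ₃ := inferInstanceAs (Mono e)
    have := mono_of_mono_τ p
    exact ⟨(Injective.factorThru q p).τ₂, congrArg Hom.τ₂ (Injective.comp_factorThru q p)⟩

/-- Extend the map `inRight I.X₃ ⟶ I` given by the identity along the inclusion into `inMidRight
I.X₃`. The middle component of the extension is a section of `I.g`. -/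
instance isSplitEpi_g_of_injective (I : ShortComplex C) [Injective I] : IsSplitEpi I.g := by
  let p : inRight I.X₃ ⟶ inMidRight I.X₃ := { τ₁ := 0, τ₂ := 0, τ₃ := 𝟙 _ }
  let q : inRight I.X₃ ⟶ I :=
    { τ₁ := 0, τ₂ := 0, τ₃ := 𝟙 _ }
  have : Mono p.τ₁ := (isZero_zero C).mono _
  have : Mono p.τ₂ := (isZero_zero C).mono _
  have : Mono p.τ₃ := inferInstanceAs (Mono (𝟙 _))
  have := mono_of_mono_τ p
  let l := Injective.factorThru q p
  have h₃ : 𝟙 I.X₃ ≫ l.τ₃ = 𝟙 I.X₃ := congrArg Hom.τ₃ (Injective.comp_factorThru q p)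
  exact ⟨⟨l.τ₂, l.comm₂₃.trans h₃⟩⟩

theorem Splitting.injective_X₁ {S : ShortComplex C} (s : S.Splitting) [Injective S.X₂] :
    Injective S.X₁ :=
  Retract.injective ⟨S.f, s.r, s.f_r⟩

theorem injective_kernel_g (I : ShortComplex C) [Injective I] : Injective (kernel I.g) :=
  have : Injective (ShortComplex.mk (kernel.ι I.g) I.g (by simp)).X₂ := injective_X₂ I
  (Splitting.ofExactOfSection (ShortComplex.mk (kernel.ι I.g) I.g (kernel.condition _))
    (ShortComplex.exact_kernel I.g) (section_ I.g) (by exact IsSplitEpi.id I.g)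
    (by dsimp; infer_instance)).injective_X₁

/-- `inMidRight`, `inLeftMid` and `inLeft` are right adjoint to `π₃`, `π₂` and `π₁`, which preserve
monomorphisms; this gives the present instance and the next two. -/
instance (X : C) [Injective X] : Injective (inMidRight X) where
  factors {Y E} f e _ := by
    have : Mono e.τ₃ := inferInstanceAs (Mono (π₃.map e))
    refine ⟨{ τ₁ := 0, τ₂ := E.g ≫ Injective.factorThru f.τ₃ e.τ₃
              τ₃ := Injective.factorThru f.τ₃ e.τ₃ }, ?_⟩
    ext
    · simpa [e.comm₂₃_assoc] using f.comm₂₃.symm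
    · simp

instance (X : C) [Injective X] : Injective (inLeftMid X) where
  factors {Y E} f e _ := by
    have : Mono e.τ₂ := inferInstanceAs (Mono (π₂.map e))
    refine ⟨{ τ₁ := E.f ≫ Injective.factorThru f.τ₂ e.τ₂
              τ₂ := Injective.factorThru f.τ₂ e.τ₂, τ₃ := 0 }, ?_⟩
    ext
    · simpa [e.comm₁₂_assoc] using f.comm₁₂.symm
    · simp

instance (X : C) [Injective X] : Injective (inLeft X) where
  factors {Y E} f e _ := by
    have : Mono e.τ₁ := inferInstanceAs (Mono (π₁.map e))
    refine ⟨{ τ₁ := Injective.factorThru f.τ₁ e.τ₁, τ₂ := 0, τ₃ := 0 }, ?_⟩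
    ext
    · simp

instance enoughInjectives [EnoughInjectives C] : EnoughInjectives (ShortComplex C) where
  presentation S := by
    let a : S ⟶ inLeft (Injective.under S.X₁) :=
      { τ₁ := Injective.ι _, τ₂ := 0, τ₃ := 0 }
    let b : S ⟶ inLeftMid (Injective.under S.X₂) :=
      { τ₁ := S.f ≫ Injective.ι _, τ₂ := Injective.ι _, τ₃ := 0 }
    let c : S ⟶ inMidRight (Injective.under S.X₃) :=
      { τ₁ := 0, τ₂ := S.g ≫ Injective.ι _, τ₃ := Injective.ι _ }
    let p := biprod.lift a (biprod.lift b c)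
    have h₁ : p ≫ biprod.fst = a := by simp [p]
    have h₂ : (p ≫ biprod.snd) ≫ biprod.fst = b := by simp [p]
    have h₃ : (p ≫ biprod.snd) ≫ biprod.snd = c := by simp [p]
    have : Mono a.τ₁ := inferInstanceAs (Mono (Injective.ι S.X₁))
    have : Mono b.τ₂ := inferInstanceAs (Mono (Injective.ι S.X₂))
    have : Mono c.τ₃ := inferInstanceAs (Mono (Injective.ι S.X₃))
    have : Mono p.τ₁ := mono_of_mono_fac (congrArg Hom.τ₁ h₁)
    have : Mono (p ≫ biprod.snd).τ₂ := mono_of_mono_fac (congrArg Hom.τ₂ h₂)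
    have : Mono p.τ₂ := mono_of_mono_fac (comp_τ₂ p biprod.snd).symm
    have : Mono (p ≫ biprod.snd).τ₃ := mono_of_mono_fac (congrArg Hom.τ₃ h₃)
    have : Mono p.τ₃ := mono_of_mono_fac (comp_τ₃ p biprod.snd).symm
    have := mono_of_mono_τ p
    exact ⟨⟨_, inferInstance, p, inferInstance⟩⟩

end Injective

end CategoryTheory.ShortComplex

namespace CategoryTheory.ShortComplex

variable {C : Type u} [Category.{v} C] [Abelian C]

instance : (π₁ : ShortComplex C ⥤ C).PreservesProjectiveObjects := ⟨fun _ => projective_X₁ _⟩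
instance : (π₂ : ShortComplex C ⥤ C).PreservesProjectiveObjects := ⟨fun _ => projective_X₂ _⟩
instance : (π₂ : ShortComplex C ⥤ C).PreservesInjectiveObjects := ⟨fun _ => injective_X₂ _⟩
instance : (π₃ : ShortComplex C ⥤ C).PreservesInjectiveObjects := ⟨fun _ => injective_X₃ _⟩
instance : (π₁ : ShortComplex C ⥤ C).Additive where
instance : (π₂ : ShortComplex C ⥤ C).Additive where
instance : (π₃ : ShortComplex C ⥤ C).Additive where

end CategoryTheory.ShortComplex

/-! ### Projective resolutions of short exact sequences. -/

namespace CategoryTheory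

/-- In a cube with five commuting faces the sixth commutes after precomposition with `q`, which can
be cancelled. -/
theorem comp_eq_comp_of_epi {C : Type u} [Category.{v} C] {A B X Y A' B' X' Y' : C} {q : A ⟶ B}
    {q' : A' ⟶ B'} {a : A ⟶ A'} {b : B ⟶ B'} {p : A ⟶ X} {r : B ⟶ Y} {p' : A' ⟶ X'} {r' : B' ⟶ Y'}
    {g : X ⟶ Y} {g' : X' ⟶ Y'} {x : X ⟶ X'} {y : Y ⟶ Y'} [Epi q] (h : q ≫ b = a ≫ q')
    (hr : q ≫ r = p ≫ g) (hr' : q' ≫ r' = p' ≫ g') (hp : a ≫ p' = p ≫ x)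
    (hg : x ≫ g' = g ≫ y) : b ≫ r' = r ≫ y := by
  rw [← cancel_epi q, reassoc_of% h, hr', reassoc_of% hp, hg, reassoc_of% hr]

end CategoryTheory

namespace CategoryTheory.ProjectiveResolution
open ShortComplex

variable {C : Type u} [Category.{v} C] [Abelian C] {S : ShortComplex C}
  (P : ProjectiveResolution S)

/-- A projective resolution of `S.X₁`. -/
noncomputable abbrev res₁ : ProjectiveResolution S.X₁ := π₁.mapProjectiveResolution P

/-- A projective resolution of `S.X₂`. -/
noncomputable abbrev res₂ : ProjectiveResolution S.X₂ := π₂.mapProjectiveResolution P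

/-- The lift of `S.f` to the projective resolutions `res₁` and `res₂`. -/
noncomputable abbrev resMap : P.res₁.complex ⟶ P.res₂.complex :=
  (NatTrans.mapHomologicalComplex π₁Toπ₂ _).app P.complex

/-- The short exact sequence of complexes of projectives attached to a projective resolution in
the category of short complexes. -/
noncomputable abbrev resShortComplex : ShortComplex (ChainComplex C ℕ) :=
  ShortComplex.mk P.resMap (cokernel.π P.resMap) (cokernel.condition _)

theorem resShortComplex_shortExact : P.resShortComplex.ShortExact := by
  have : Mono P.resMap := HomologicalComplex.mono_of_mono_f _ fun n =>
    inferInstanceAs (Mono (P.complex.X n).f)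
  exact { exact := ShortComplex.exact_cokernel _, mono_f := this, epi_g := inferInstance }

/-- Evaluation in degree `n` preserves cokernels, so this term is the cokernel of `(P.complex.X
n).f`. -/
instance (n : ℕ) : Projective (P.resShortComplex.X₃.X n) :=
  have := projective_cokernel_f (P.complex.X n)
  Projective.of_iso (PreservesCokernel.iso (HomologicalComplex.eval C _ n) P.resMap).symm this

theorem res₁_π_f_zero : P.res₁.π.f 0 = (P.π.f 0).τ₁ := by
  simp only [Functor.mapProjectiveResolution_π, HomologicalComplex.comp_f,
    HomologicalComplex.singleMapHomologicalComplex_hom_app_self]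
  -- In degree zero both identifications of the single complex with its object unfold to identities.
  exact (congrArg _ (Category.comp_id _)).trans (Category.comp_id _)

theorem res₂_π_f_zero : P.res₂.π.f 0 = (P.π.f 0).τ₂ := by
  simp only [Functor.mapProjectiveResolution_π, HomologicalComplex.comp_f,
    HomologicalComplex.singleMapHomologicalComplex_hom_app_self]
  exact (congrArg _ (Category.comp_id _)).trans (Category.comp_id _)

theorem resMap_comp_π : P.resMap ≫ P.res₂.π = P.res₁.π ≫ (ChainComplex.single₀ C).map S.f := by
  refine HomologicalComplex.to_single_hom_ext ?_
  rw [HomologicalComplex.comp_f, HomologicalComplex.comp_f, res₁_π_f_zero, res₂_π_f_zero,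
    ChainComplex.single₀_map_f_zero]
  exact (P.π.f 0).comm₁₂.symm

theorem resMap_comp_π_comp :
    P.resMap ≫ P.res₂.π ≫ (ChainComplex.single₀ C).map S.g = 0 := by
  rw [← Category.assoc, resMap_comp_π, Category.assoc, ← Functor.map_comp, S.zero,
    Functor.map_zero, comp_zero]

/-- The augmentation. -/
noncomputable def resπ : P.resShortComplex ⟶ S.map (ChainComplex.single₀ C) where
  τ₁ := P.res₁.π
  τ₂ := P.res₂.π
  τ₃ := cokernel.desc _ (P.res₂.π ≫ (ChainComplex.single₀ C).map S.g) P.resMap_comp_π_comp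
  comm₁₂ := P.resMap_comp_π.symm
  comm₂₃ := (cokernel.π_desc _ _ _).symm

/-- Five lemma on the long homology sequences: the augmentation is a quasi-isomorphism on the first
two terms, and both rows are short exact. -/
theorem quasiIso_resπ (hS : S.ShortExact) : QuasiIso P.resπ.τ₃ :=
  HomologicalComplex.HomologySequence.quasiIso_τ₃ P.resπ P.resShortComplex_shortExact
    (hS.map_of_exact _) P.res₁.quasiIso P.res₂.quasiIso

/-- A projective resolution of `S.X₃`. -/
noncomputable abbrev res₃ (hS : S.ShortExact) : ProjectiveResolution S.X₃ where
  complex := P.resShortComplex.X₃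
  π := P.resπ.τ₃
  quasiIso := P.quasiIso_resπ hS

theorem resMap_f_zero_comp : P.resMap.f 0 ≫ P.res₂.π.f 0 = P.res₁.π.f 0 ≫ S.f := by
  have := HomologicalComplex.congr_hom P.resMap_comp_π 0
  rwa [HomologicalComplex.comp_f, HomologicalComplex.comp_f,
    ChainComplex.single₀_map_f_zero] at this

theorem resπ_f_zero_comp (hS : S.ShortExact) :
    (cokernel.π P.resMap).f 0 ≫ (P.res₃ hS).π.f 0 = P.res₂.π.f 0 ≫ S.g := by
  have h : cokernel.π P.resMap ≫ (P.res₃ hS).π = P.res₂.π ≫ (ChainComplex.single₀ C).map S.g :=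
    cokernel.π_desc _ _ _
  have := HomologicalComplex.congr_hom h 0
  rwa [HomologicalComplex.comp_f, HomologicalComplex.comp_f,
    ChainComplex.single₀_map_f_zero] at this

section

variable {S' : ShortComplex C} (P' : ProjectiveResolution S') (φ : S ⟶ S')

/-- A lift of a morphism of short complexes. -/
noncomputable def resLift : P.resShortComplex ⟶ P'.resShortComplex where
  τ₁ := (π₁.mapHomologicalComplex _).map (lift φ P P')
  τ₂ := (π₂.mapHomologicalComplex _).map (lift φ P P')
  τ₃ := cokernel.map _ _ ((π₁.mapHomologicalComplex _).map (lift φ P P'))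
    ((π₂.mapHomologicalComplex _).map (lift φ P P'))
    ((NatTrans.mapHomologicalComplex π₁Toπ₂ _).naturality (lift φ P P')).symm
  comm₁₂ := (NatTrans.mapHomologicalComplex π₁Toπ₂ _).naturality (lift φ P P')
  comm₂₃ := (cokernel.π_desc _ _ _).symm

theorem resLift_τ₁_comp :
    (P.resLift P' φ).τ₁.f 0 ≫ P'.res₁.π.f 0 = P.res₁.π.f 0 ≫ φ.τ₁ := by
  rw [res₁_π_f_zero, res₁_π_f_zero]
  exact congrArg Hom.τ₁ (lift_commutes_zero φ P P')

theorem resLift_τ₂_comp :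
    (P.resLift P' φ).τ₂.f 0 ≫ P'.res₂.π.f 0 = P.res₂.π.f 0 ≫ φ.τ₂ := by
  rw [res₂_π_f_zero, res₂_π_f_zero]
  exact congrArg Hom.τ₂ (lift_commutes_zero φ P P')

/-- The compatibility on the second terms descends along the cokernel projection. -/
theorem resLift_τ₃_comp (hS : S.ShortExact) (hS' : S'.ShortExact) :
    (P.resLift P' φ).τ₃.f 0 ≫ (P'.res₃ hS').π.f 0 = (P.res₃ hS).π.f 0 ≫ φ.τ₃ := by
  have : Epi ((cokernel.π P.resMap).f 0) := inferInstance
  exact comp_eq_comp_of_epi (HomologicalComplex.congr_hom (P.resLift P' φ).comm₂₃.symm 0)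
    (P.resπ_f_zero_comp hS) (P'.resπ_f_zero_comp hS') (P.resLift_τ₂_comp P' φ) φ.comm₂₃

end

/-- No exactness of `F` is needed: in each degree the third term is projective, so the sequence
splits, and additive functors preserve splittings. -/
theorem resShortComplex_map_shortExact {D : Type*} [Category* D] [Abelian D] (F : C ⥤ D)
    [F.Additive] : (P.resShortComplex.map (F.mapHomologicalComplex _)).ShortExact :=
  HomologicalComplex.shortExact_of_degreewise_shortExact _ fun n => by
    have h := P.resShortComplex_shortExact.map_of_exact (HomologicalComplex.eval C _ n)
    have : Projective (P.resShortComplex.map (HomologicalComplex.eval C _ n)).X₃ :=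
      inferInstanceAs (Projective (P.resShortComplex.X₃.X n))
    exact (h.splittingOfProjective.map F).shortExact

end CategoryTheory.ProjectiveResolution

theorem AddCommGrpCat.function_exact_of_iso {X Y Z : AddCommGrpCat.{w}} {f : X ⟶ Y} {g : Y ⟶ Z}
    {S : ShortComplex AddCommGrpCat.{w}} (hS : S.Exact) (a : X ≅ S.X₁) (b : Y ≅ S.X₂)
    (c : Z ≅ S.X₃) (hf : f ≫ b.hom = a.hom ≫ S.f) (hg : g ≫ c.hom = b.hom ≫ S.g) :
    Function.Exact f g := by
  have w : f ≫ g = 0 := by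
    rw [← cancel_mono c.hom, Category.assoc, hg, reassoc_of% hf, S.zero, comp_zero, zero_comp]
  exact (ShortComplex.ab_exact_iff_function_exact (ShortComplex.mk f g w)).1
    (ShortComplex.exact_of_iso (ShortComplex.isoMk (S₁ := ShortComplex.mk f g w) a b c
      hf.symm hg.symm).symm hS)

/-! ### Long exact sequences of left derived functors. -/

section

variable {C : Type u} [Category.{v} C] [Abelian C]

open HomologicalComplex in
/-- Long exact sequences for functors computed by the homology of short exact sequences of chain
complexes. -/
noncomputable def HomologicalSequences.ofChainComplexes {E : ℕ → C ⥤ AddCommGrpCat.{w}}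
    (K : ∀ S : ShortComplex C, S.ShortExact → ShortComplex (ChainComplex AddCommGrpCat.{w} ℕ))
    (hK : ∀ S hS, (K S hS).ShortExact)
    (e₁ : ∀ S hS r, (E r).obj S.X₁ ≅ (K S hS).X₁.homology r)
    (e₂ : ∀ S hS r, (E r).obj S.X₂ ≅ (K S hS).X₂.homology r)
    (e₃ : ∀ S hS r, (E r).obj S.X₃ ≅ (K S hS).X₃.homology r)
    (hf : ∀ S hS r, (E r).map S.f ≫ (e₂ S hS r).hom =
      (e₁ S hS r).hom ≫ homologyMap (K S hS).f r)
    (hg : ∀ S hS r, (E r).map S.g ≫ (e₃ S hS r).hom =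
      (e₂ S hS r).hom ≫ homologyMap (K S hS).g r)
    (hφ : ∀ (S S' : ShortComplex C) hS hS' (φ : S ⟶ S'), ∃ ψ : K S hS ⟶ K S' hS',
      (∀ r, (E r).map φ.τ₁ ≫ (e₁ S' hS' r).hom = (e₁ S hS r).hom ≫ homologyMap ψ.τ₁ r) ∧
      ∀ r, (E r).map φ.τ₃ ≫ (e₃ S' hS' r).hom = (e₃ S hS r).hom ≫ homologyMap ψ.τ₃ r) :
    HomologicalSequences E where
  δ S hS r := (e₃ S hS (r + 1)).hom ≫ (hK S hS).δ (r + 1) r (by simp) ≫ (e₁ S hS r).inv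
  naturality S S' hS hS' φ r := by
    -- The connecting maps do not involve `ψ`, so any compatible morphism of the sequences of
    -- complexes will do.
    obtain ⟨ψ, h₁, h₃⟩ := hφ S S' hS hS' φ
    rw [← cancel_mono (e₁ S' hS' r).hom]
    simp only [Category.assoc, h₁, reassoc_of% h₃, Iso.inv_hom_id_assoc, Iso.inv_hom_id,
      Category.comp_id, HomologySequence.δ_naturality ψ (hK S hS) (hK S' hS')]
  surjective S hS := by
    have := (hK S hS).epi_g
    -- No differential leaves degree zero, so homology there is a cokernel and preserves
    -- epimorphisms.
    have : Epi (homologyMap (K S hS).g 0) := epi_homologyMap_of_epi_of_not_rel _ 0 (by simp)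
    have h : (E 0).map S.g = (e₂ S hS 0).hom ≫ homologyMap (K S hS).g 0 ≫ (e₃ S hS 0).inv := by
      rw [← cancel_mono (e₃ S hS 0).hom]
      simp [hg]
    rw [← AddCommGrpCat.epi_iff_surjective, h]
    infer_instance
  exact_middle S hS r := AddCommGrpCat.function_exact_of_iso ((hK S hS).homology_exact₂ r)
    (e₁ S hS r) (e₂ S hS r) (e₃ S hS r) (hf S hS r) (hg S hS r)
  exact_right S hS r := AddCommGrpCat.function_exact_of_iso
    ((hK S hS).homology_exact₃ (r + 1) r (by simp)) (e₂ S hS _) (e₃ S hS _) (e₁ S hS _)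
    (hg S hS _) (by simp)
  exact_left S hS r := AddCommGrpCat.function_exact_of_iso
    ((hK S hS).homology_exact₁ (r + 1) r (by simp)) (e₃ S hS _) (e₁ S hS _) (e₂ S hS _)
    (by simp) (hf S hS _)

/-- The long exact sequences of the left derived functors of an additive functor. -/
noncomputable def CategoryTheory.Functor.homologicalSequences [EnoughProjectives C]
    (F : C ⥤ AddCommGrpCat.{w}) [F.Additive] : HomologicalSequences fun r => F.leftDerived r :=
  .ofChainComplexes
    (fun S _ => (projectiveResolution S).resShortComplex.map (F.mapHomologicalComplex _))
    (fun S _ => (projectiveResolution S).resShortComplex_map_shortExact F)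
    (fun S _ r => (projectiveResolution S).res₁.isoLeftDerivedObj F r)
    (fun S _ r => (projectiveResolution S).res₂.isoLeftDerivedObj F r)
    (fun S hS r => ((projectiveResolution S).res₃ hS).isoLeftDerivedObj F r)
    (fun S _ r => ProjectiveResolution.isoLeftDerivedObj_hom_naturality S.f _ _ _
      (projectiveResolution S).resMap_f_zero_comp F r)
    (fun S hS r => ProjectiveResolution.isoLeftDerivedObj_hom_naturality S.g
      (projectiveResolution S).res₂ ((projectiveResolution S).res₃ hS) _
      ((projectiveResolution S).resπ_f_zero_comp hS) F r)
    fun S S' hS hS' φ =>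
      ⟨(F.mapHomologicalComplex _).mapShortComplex.map
        ((projectiveResolution S).resLift (projectiveResolution S') φ),
      fun r => ProjectiveResolution.isoLeftDerivedObj_hom_naturality φ.τ₁ _ _ _
        ((projectiveResolution S).resLift_τ₁_comp (projectiveResolution S') φ) F r,
      fun r => ProjectiveResolution.isoLeftDerivedObj_hom_naturality φ.τ₃
        ((projectiveResolution S).res₃ hS) ((projectiveResolution S').res₃ hS') _
        ((projectiveResolution S).resLift_τ₃_comp (projectiveResolution S') φ hS hS') F r⟩

end

/-! ### The five lemma for the first term of a short exact sequence of complexes. -/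

section

open HomologicalComplex HomologySequence ComposableArrows Abelian

variable {C : Type u} [Category.{v} C] [Abelian C] {ι : Type w} {c : ComplexShape ι}
  {S₁ S₂ : ShortComplex (HomologicalComplex C c)}

/-- The five lemma as two four lemmas, for mono and for epi, on four-term pieces of the six-term
sequence from degree `i` to `j`. If no degree maps to `j`, the sequence begins with a monomorphism
at `j`, which takes the place of the terms in degree `i`. -/
theorem HomologicalComplex.HomologySequence.isIso_homologyMap_τ₁ (φ : S₁ ⟶ S₂)
    (hS₁ : S₁.ShortExact) (hS₂ : S₂.ShortExact) (h₂ : QuasiIso φ.τ₂) (h₃ : QuasiIso φ.τ₃) (j : ι) :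
    IsIso (homologyMap φ.τ₁ j) := by
  by_cases hj : ∃ i, c.Rel i j
  · obtain ⟨i, hij⟩ := hj
    have : Mono (homologyMap φ.τ₁ j) :=
      mono_of_epi_of_mono_of_mono
        ((δ₀Functor ⋙ δlastFunctor).map (mapComposableArrows₅ φ hS₁ hS₂ i j hij))
        (composableArrows₅_exact hS₁ i j hij).δ₀.δlast
        (composableArrows₅_exact hS₂ i j hij).δ₀.δlast
        (inferInstanceAs (Epi (homologyMap φ.τ₂ i)))
        (inferInstanceAs (Mono (homologyMap φ.τ₃ i)))
        (inferInstanceAs (Mono (homologyMap φ.τ₂ j)))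
    have : Epi (homologyMap φ.τ₁ j) :=
      epi_of_epi_of_epi_of_mono
        ((δ₀Functor ⋙ δ₀Functor).map (mapComposableArrows₅ φ hS₁ hS₂ i j hij))
        (composableArrows₅_exact hS₁ i j hij).δ₀.δ₀
        (composableArrows₅_exact hS₂ i j hij).δ₀.δ₀
        (inferInstanceAs (Epi (homologyMap φ.τ₃ i)))
        (inferInstanceAs (Epi (homologyMap φ.τ₂ j)))
        (inferInstanceAs (Mono (homologyMap φ.τ₃ j)))
    exact isIso_of_mono_of_epi _
  · have := hS₁.mono_f
    have := hS₂.mono_f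
    have hj' : ∀ i, ¬ c.Rel i j := by simpa using hj
    have := mono_homologyMap_of_mono_of_not_rel S₁.f j hj'
    have h := mono_homologyMap_of_mono_of_not_rel S₂.f j hj'
    have e : homologyMap φ.τ₁ j ≫ homologyMap S₂.f j =
        homologyMap S₁.f j ≫ homologyMap φ.τ₂ j := by
      rw [← homologyMap_comp, ← homologyMap_comp, φ.comm₁₂]
    have : Mono (homologyMap φ.τ₁ j) := mono_of_mono_fac e
    have : Epi (homologyMap φ.τ₁ j) :=
      epi_of_mono_of_epi_of_mono (mapComposableArrows₂ φ j)
        (composableArrows₂_exact hS₁ j) (composableArrows₂_exact hS₂ j) h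
        (inferInstanceAs (Epi (homologyMap φ.τ₂ j)))
        (inferInstanceAs (Mono (homologyMap φ.τ₃ j)))
    exact isIso_of_mono_of_epi _

theorem HomologicalComplex.HomologySequence.quasiIso_τ₁ (φ : S₁ ⟶ S₂)
    (hS₁ : S₁.ShortExact) (hS₂ : S₂.ShortExact) (h₂ : QuasiIso φ.τ₂) (h₃ : QuasiIso φ.τ₃) :
    QuasiIso φ.τ₁ := by
  rw [quasiIso_iff]
  intro j
  rw [quasiIsoAt_iff_isIso_homologyMap]
  exact isIso_homologyMap_τ₁ φ hS₁ hS₂ h₂ h₃ j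

end

/-! ### Injective resolutions of short exact sequences. -/

namespace CategoryTheory

/-- The dual cube: the sixth face commutes after composition with the monomorphism `k'`. -/
theorem comp_eq_comp_of_mono {C : Type u} [Category.{v} C] {A B X Y A' B' X' Y' : C} {i : A ⟶ X}
    {j : B ⟶ Y} {i' : A' ⟶ X'} {j' : B' ⟶ Y'} {f : A ⟶ B} {f' : A' ⟶ B'} {k : X ⟶ Y}
    {k' : X' ⟶ Y'} {a : A ⟶ A'} {b : B ⟶ B'} {x : X ⟶ X'} {y : Y ⟶ Y'} [Mono k']
    (h : x ≫ k' = k ≫ y) (hi : i ≫ k = f ≫ j) (hi' : i' ≫ k' = f' ≫ j')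
    (hj : j ≫ y = b ≫ j') (hf : a ≫ f' = f ≫ b) : i ≫ x = a ≫ i' := by
  rw [← cancel_mono k', Category.assoc, Category.assoc, h, hi', reassoc_of% hi, hj,
    reassoc_of% hf]

variable {C : Type u} [Category.{v} C] [Abelian C]

/-- The image of an injective resolution under an exact functor which preserves injective
objects. -/
@[simps cocomplex ι]
noncomputable def Functor.mapInjectiveResolution {D : Type*} [Category* D] [Abelian D]
    (F : C ⥤ D) [F.Additive] [F.PreservesInjectiveObjects] [F.PreservesHomology] {Z : C}
    (I : InjectiveResolution Z) : InjectiveResolution (F.obj Z) where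
  cocomplex := (F.mapHomologicalComplex _).obj I.cocomplex
  injective n := Functor.PreservesInjectiveObjects.injective_obj (I.injective n)
  ι := (HomologicalComplex.singleMapHomologicalComplex _ _ _).inv.app _ ≫
    (F.mapHomologicalComplex _).map I.ι
  quasiIso := inferInstance

namespace InjectiveResolution
open ShortComplex

variable {S : ShortComplex C} (I : InjectiveResolution S)

/-- An injective resolution of `S.X₂`. -/
noncomputable abbrev res₂ : InjectiveResolution S.X₂ := π₂.mapInjectiveResolution I

/-- An injective resolution of `S.X₃`. -/
noncomputable abbrev res₃ : InjectiveResolution S.X₃ := π₃.mapInjectiveResolution I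

/-- The extension of `S.g` to the injective resolutions `res₂` and `res₃`. -/
noncomputable abbrev resMap : I.res₂.cocomplex ⟶ I.res₃.cocomplex :=
  (NatTrans.mapHomologicalComplex π₂Toπ₃ _).app I.cocomplex

/-- The short exact sequence of complexes of injectives attached to an injective resolution in
the category of short complexes. -/
noncomputable abbrev resShortComplex : ShortComplex (CochainComplex C ℕ) :=
  ShortComplex.mk (kernel.ι I.resMap) I.resMap (kernel.condition _)

theorem resShortComplex_shortExact : I.resShortComplex.ShortExact := by
  have : Epi I.resMap := HomologicalComplex.epi_of_epi_f _ fun n =>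
    inferInstanceAs (Epi (I.cocomplex.X n).g)
  exact { exact := ShortComplex.exact_kernel _, mono_f := inferInstance, epi_g := this }

instance (n : ℕ) : Injective (I.resShortComplex.X₁.X n) :=
  have := injective_kernel_g (I.cocomplex.X n)
  Injective.of_iso (PreservesKernel.iso (HomologicalComplex.eval C _ n) I.resMap).symm this

theorem res₂_ι_f_zero : I.res₂.ι.f 0 = (I.ι.f 0).τ₂ := by
  simp only [Functor.mapInjectiveResolution_ι, HomologicalComplex.comp_f,
    HomologicalComplex.singleMapHomologicalComplex_inv_app_self]
  exact (Category.assoc _ _ _).trans ((Category.id_comp _).trans (Category.id_comp _))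

theorem res₃_ι_f_zero : I.res₃.ι.f 0 = (I.ι.f 0).τ₃ := by
  simp only [Functor.mapInjectiveResolution_ι, HomologicalComplex.comp_f,
    HomologicalComplex.singleMapHomologicalComplex_inv_app_self]
  exact (Category.assoc _ _ _).trans ((Category.id_comp _).trans (Category.id_comp _))

theorem ι_comp_resMap : I.res₂.ι ≫ I.resMap = (CochainComplex.single₀ C).map S.g ≫ I.res₃.ι := by
  refine HomologicalComplex.from_single_hom_ext ?_
  rw [HomologicalComplex.comp_f, HomologicalComplex.comp_f, res₂_ι_f_zero, res₃_ι_f_zero,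
    CochainComplex.single₀_map_f_zero]
  exact (I.ι.f 0).comm₂₃

theorem comp_ι_comp_resMap :
    ((CochainComplex.single₀ C).map S.f ≫ I.res₂.ι) ≫ I.resMap = 0 := by
  rw [Category.assoc, ι_comp_resMap, ← Category.assoc, ← Functor.map_comp, S.zero,
    Functor.map_zero, zero_comp]

/-- The augmentation. -/
noncomputable def resι : S.map (CochainComplex.single₀ C) ⟶ I.resShortComplex where
  τ₁ := kernel.lift _ ((CochainComplex.single₀ C).map S.f ≫ I.res₂.ι) I.comp_ι_comp_resMap
  τ₂ := I.res₂.ι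
  τ₃ := I.res₃.ι
  comm₁₂ := kernel.lift_ι _ _ _
  comm₂₃ := I.ι_comp_resMap

/-- Here the unknown term is the first one, so the five lemma is applied in the form `quasiIso_τ₁`.
-/
theorem quasiIso_resι (hS : S.ShortExact) : QuasiIso I.resι.τ₁ :=
  HomologicalComplex.HomologySequence.quasiIso_τ₁ I.resι (hS.map_of_exact _)
    I.resShortComplex_shortExact I.res₂.quasiIso I.res₃.quasiIso

/-- An injective resolution of `S.X₁`. -/
noncomputable abbrev res₁ (hS : S.ShortExact) : InjectiveResolution S.X₁ where
  cocomplex := I.resShortComplex.X₁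
  ι := I.resι.τ₁
  quasiIso := I.quasiIso_resι hS

theorem comp_resMap_f_zero : I.res₂.ι.f 0 ≫ I.resMap.f 0 = S.g ≫ I.res₃.ι.f 0 := by
  have := HomologicalComplex.congr_hom I.ι_comp_resMap 0
  rwa [HomologicalComplex.comp_f, HomologicalComplex.comp_f,
    CochainComplex.single₀_map_f_zero] at this

theorem comp_resι_f_zero (hS : S.ShortExact) :
    (I.res₁ hS).ι.f 0 ≫ (kernel.ι I.resMap).f 0 = S.f ≫ I.res₂.ι.f 0 := by
  have h : (I.res₁ hS).ι ≫ kernel.ι I.resMap = (CochainComplex.single₀ C).map S.f ≫ I.res₂.ι :=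
    kernel.lift_ι _ _ _
  have := HomologicalComplex.congr_hom h 0
  rwa [HomologicalComplex.comp_f, HomologicalComplex.comp_f,
    CochainComplex.single₀_map_f_zero] at this

section

variable {S' : ShortComplex C} (I' : InjectiveResolution S') (φ : S ⟶ S')

/-- An extension of a morphism of short complexes. -/
noncomputable def resDesc : I.resShortComplex ⟶ I'.resShortComplex where
  τ₁ := kernel.map _ _ ((π₂.mapHomologicalComplex _).map (desc φ I' I))
    ((π₃.mapHomologicalComplex _).map (desc φ I' I))
    ((NatTrans.mapHomologicalComplex π₂Toπ₃ _).naturality (desc φ I' I)).symm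
  τ₂ := (π₂.mapHomologicalComplex _).map (desc φ I' I)
  τ₃ := (π₃.mapHomologicalComplex _).map (desc φ I' I)
  comm₁₂ := kernel.lift_ι _ _ _
  comm₂₃ := (NatTrans.mapHomologicalComplex π₂Toπ₃ _).naturality (desc φ I' I)

theorem comp_resDesc_τ₂ :
    I.res₂.ι.f 0 ≫ (I.resDesc I' φ).τ₂.f 0 = φ.τ₂ ≫ I'.res₂.ι.f 0 := by
  rw [res₂_ι_f_zero, res₂_ι_f_zero]
  exact congrArg Hom.τ₂ (desc_commutes_zero φ I' I)

theorem comp_resDesc_τ₃ :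
    I.res₃.ι.f 0 ≫ (I.resDesc I' φ).τ₃.f 0 = φ.τ₃ ≫ I'.res₃.ι.f 0 := by
  rw [res₃_ι_f_zero, res₃_ι_f_zero]
  exact congrArg Hom.τ₃ (desc_commutes_zero φ I' I)

theorem comp_resDesc_τ₁ (hS : S.ShortExact) (hS' : S'.ShortExact) :
    (I.res₁ hS).ι.f 0 ≫ (I.resDesc I' φ).τ₁.f 0 = φ.τ₁ ≫ (I'.res₁ hS').ι.f 0 := by
  have : Mono ((kernel.ι I'.resMap).f 0) := inferInstance
  exact comp_eq_comp_of_mono (HomologicalComplex.congr_hom (I.resDesc I' φ).comm₁₂ 0)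
    (I.comp_resι_f_zero hS) (I'.comp_resι_f_zero hS') (I.comp_resDesc_τ₂ I' φ) φ.comm₁₂

end

/-- The first term is injective in each degree, so the sequence splits there and any additive `F`
preserves it. -/
theorem resShortComplex_map_shortExact {D : Type*} [Category* D] [Abelian D] (F : C ⥤ D)
    [F.Additive] : (I.resShortComplex.map (F.mapHomologicalComplex _)).ShortExact :=
  HomologicalComplex.shortExact_of_degreewise_shortExact _ fun n => by
    have h := I.resShortComplex_shortExact.map_of_exact (HomologicalComplex.eval C _ n)
    have : Injective (I.resShortComplex.map (HomologicalComplex.eval C _ n)).X₁ :=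
      inferInstanceAs (Injective (I.resShortComplex.X₁.X n))
    exact (h.splittingOfInjective.map F).shortExact

end InjectiveResolution

end CategoryTheory

/-! ### Long exact sequences from short exact sequences of cochain complexes. -/

section

variable {C : Type u} [Category.{v} C] [Abelian C]

open HomologicalComplex in
/-- Long exact sequences for functors computed by the homology of short exact sequences of cochain
complexes. -/
noncomputable def CohomologicalSequences.ofCochainComplexes {E : ℕ → C ⥤ AddCommGrpCat.{w}}
    (K : ∀ S : ShortComplex C, S.ShortExact → ShortComplex (CochainComplex AddCommGrpCat.{w} ℕ))
    (hK : ∀ S hS, (K S hS).ShortExact)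
    (e₁ : ∀ S hS r, (E r).obj S.X₁ ≅ (K S hS).X₁.homology r)
    (e₂ : ∀ S hS r, (E r).obj S.X₂ ≅ (K S hS).X₂.homology r)
    (e₃ : ∀ S hS r, (E r).obj S.X₃ ≅ (K S hS).X₃.homology r)
    (hf : ∀ S hS r, (E r).map S.f ≫ (e₂ S hS r).hom =
      (e₁ S hS r).hom ≫ homologyMap (K S hS).f r)
    (hg : ∀ S hS r, (E r).map S.g ≫ (e₃ S hS r).hom =
      (e₂ S hS r).hom ≫ homologyMap (K S hS).g r)
    (hφ : ∀ (S S' : ShortComplex C) hS hS' (φ : S ⟶ S'), ∃ ψ : K S hS ⟶ K S' hS',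
      (∀ r, (E r).map φ.τ₁ ≫ (e₁ S' hS' r).hom = (e₁ S hS r).hom ≫ homologyMap ψ.τ₁ r) ∧
      ∀ r, (E r).map φ.τ₃ ≫ (e₃ S' hS' r).hom = (e₃ S hS r).hom ≫ homologyMap ψ.τ₃ r) :
    CohomologicalSequences E where
  δ S hS r := (e₃ S hS r).hom ≫ (hK S hS).δ r (r + 1) (by simp) ≫ (e₁ S hS (r + 1)).inv
  naturality S S' hS hS' φ r := by
    obtain ⟨ψ, h₁, h₃⟩ := hφ S S' hS hS' φ
    rw [← cancel_mono (e₁ S' hS' (r + 1)).hom]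
    simp only [Category.assoc, h₁, reassoc_of% h₃, Iso.inv_hom_id_assoc, Iso.inv_hom_id,
      Category.comp_id, HomologySequence.δ_naturality ψ (hK S hS) (hK S' hS')]
  injective S hS := by
    have := (hK S hS).mono_f
    -- No differential enters degree zero, so cohomology there is a kernel and preserves
    -- monomorphisms.
    have : Mono (homologyMap (K S hS).f 0) := mono_homologyMap_of_mono_of_not_rel _ 0 (by simp)
    have h : (E 0).map S.f = (e₁ S hS 0).hom ≫ homologyMap (K S hS).f 0 ≫ (e₂ S hS 0).inv := by
      rw [← cancel_mono (e₂ S hS 0).hom]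
      simp [hf]
    rw [← AddCommGrpCat.mono_iff_injective, h]
    infer_instance
  exact_middle S hS r := AddCommGrpCat.function_exact_of_iso ((hK S hS).homology_exact₂ r)
    (e₁ S hS r) (e₂ S hS r) (e₃ S hS r) (hf S hS r) (hg S hS r)
  exact_right S hS r := AddCommGrpCat.function_exact_of_iso
    ((hK S hS).homology_exact₃ r (r + 1) (by simp)) (e₂ S hS _) (e₃ S hS _) (e₁ S hS _)
    (hg S hS _) (by simp)
  exact_left S hS r := AddCommGrpCat.function_exact_of_iso
    ((hK S hS).homology_exact₁ r (r + 1) (by simp)) (e₃ S hS _) (e₁ S hS _) (e₂ S hS _)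
    (by simp) (hf S hS _)

open HomologicalComplex in
/-- Long exact sequences for contravariant functors computed by the homology of short exact
sequences of cochain complexes. -/
noncomputable def ContravariantSequences.ofCochainComplexes {E : ℕ → Cᵒᵖ ⥤ AddCommGrpCat.{w}}
    (K : ∀ S : ShortComplex C, S.ShortExact → ShortComplex (CochainComplex AddCommGrpCat.{w} ℕ))
    (hK : ∀ S hS, (K S hS).ShortExact)
    (e₁ : ∀ S hS r, (E r).obj (Opposite.op S.X₁) ≅ (K S hS).X₃.homology r)
    (e₂ : ∀ S hS r, (E r).obj (Opposite.op S.X₂) ≅ (K S hS).X₂.homology r)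
    (e₃ : ∀ S hS r, (E r).obj (Opposite.op S.X₃) ≅ (K S hS).X₁.homology r)
    (hf : ∀ S hS r, (E r).map S.f.op ≫ (e₁ S hS r).hom =
      (e₂ S hS r).hom ≫ homologyMap (K S hS).g r)
    (hg : ∀ S hS r, (E r).map S.g.op ≫ (e₂ S hS r).hom =
      (e₃ S hS r).hom ≫ homologyMap (K S hS).f r)
    (hφ : ∀ (S S' : ShortComplex C) hS hS' (φ : S ⟶ S'), ∃ ψ : K S' hS' ⟶ K S hS,
      (∀ r, (E r).map φ.τ₁.op ≫ (e₁ S hS r).hom = (e₁ S' hS' r).hom ≫ homologyMap ψ.τ₃ r) ∧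
      ∀ r, (E r).map φ.τ₃.op ≫ (e₃ S hS r).hom = (e₃ S' hS' r).hom ≫ homologyMap ψ.τ₁ r) :
    ContravariantSequences E where
  δ S hS r := (e₁ S hS r).hom ≫ (hK S hS).δ r (r + 1) (by simp) ≫ (e₃ S hS (r + 1)).inv
  naturality S S' hS hS' φ r := by
    obtain ⟨ψ, h₁, h₃⟩ := hφ S S' hS hS' φ
    rw [← cancel_mono (e₃ S hS (r + 1)).hom]
    simp only [Category.assoc, h₃, reassoc_of% h₁, Iso.inv_hom_id_assoc, Iso.inv_hom_id,
      Category.comp_id, HomologySequence.δ_naturality ψ (hK S' hS') (hK S hS)]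
  injective S hS := by
    have := (hK S hS).mono_f
    have : Mono (homologyMap (K S hS).f 0) := mono_homologyMap_of_mono_of_not_rel _ 0 (by simp)
    have h : (E 0).map S.g.op =
        (e₃ S hS 0).hom ≫ homologyMap (K S hS).f 0 ≫ (e₂ S hS 0).inv := by
      rw [← cancel_mono (e₂ S hS 0).hom]
      simp [hg]
    rw [← AddCommGrpCat.mono_iff_injective, h]
    infer_instance
  exact_middle S hS r := AddCommGrpCat.function_exact_of_iso ((hK S hS).homology_exact₂ r)
    (e₃ S hS r) (e₂ S hS r) (e₁ S hS r) (hg S hS r) (hf S hS r)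
  exact_left S hS r := AddCommGrpCat.function_exact_of_iso
    ((hK S hS).homology_exact₃ r (r + 1) (by simp)) (e₂ S hS _) (e₁ S hS _) (e₃ S hS _)
    (hf S hS _) (by simp)
  exact_right S hS r := AddCommGrpCat.function_exact_of_iso
    ((hK S hS).homology_exact₁ r (r + 1) (by simp)) (e₁ S hS _) (e₃ S hS _) (e₂ S hS _)
    (by simp) (hg S hS _)

variable [EnoughInjectives C]

/-- The long exact sequences of the right derived functors of an additive functor. -/
noncomputable def CategoryTheory.Functor.cohomologicalSequences (F : C ⥤ AddCommGrpCat.{w})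
    [F.Additive] : CohomologicalSequences fun r => F.rightDerived r :=
  .ofCochainComplexes
    (fun S _ => (injectiveResolution S).resShortComplex.map (F.mapHomologicalComplex _))
    (fun S _ => (injectiveResolution S).resShortComplex_map_shortExact F)
    (fun S hS r => ((injectiveResolution S).res₁ hS).isoRightDerivedObj F r)
    (fun S _ r => (injectiveResolution S).res₂.isoRightDerivedObj F r)
    (fun S _ r => (injectiveResolution S).res₃.isoRightDerivedObj F r)
    (fun S hS r => InjectiveResolution.isoRightDerivedObj_hom_naturality S.f
      ((injectiveResolution S).res₁ hS) (injectiveResolution S).res₂ _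
      ((injectiveResolution S).comp_resι_f_zero hS) F r)
    (fun S _ r => InjectiveResolution.isoRightDerivedObj_hom_naturality S.g
      (injectiveResolution S).res₂ (injectiveResolution S).res₃ _
      (injectiveResolution S).comp_resMap_f_zero F r)
    fun S S' hS hS' φ =>
      ⟨(F.mapHomologicalComplex _).mapShortComplex.map
        ((injectiveResolution S).resDesc (injectiveResolution S') φ),
      fun r => InjectiveResolution.isoRightDerivedObj_hom_naturality φ.τ₁
        ((injectiveResolution S).res₁ hS) ((injectiveResolution S').res₁ hS') _
        ((injectiveResolution S).comp_resDesc_τ₁ (injectiveResolution S') φ hS hS') F r,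
      fun r => InjectiveResolution.isoRightDerivedObj_hom_naturality φ.τ₃
        (injectiveResolution S).res₃ (injectiveResolution S').res₃ _
        ((injectiveResolution S).comp_resDesc_τ₃ (injectiveResolution S') φ) F r⟩

end

/-! ### The contravariant variable of `Ext`. -/

namespace CategoryTheory.ShortComplex

variable {C : Type u} [Category.{v} C] [Abelian C]

/-- The complexes `Hom(S.X₃, K) ⟶ Hom(S.X₂, K) ⟶ Hom(S.X₁, K)`. -/
noncomputable abbrev homTo (S : ShortComplex C) (K : CochainComplex C ℕ) :
    ShortComplex (CochainComplex AddCommGrpCat.{v} ℕ) :=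
  ShortComplex.mk ((NatTrans.mapHomologicalComplex (preadditiveCoyoneda.map S.g.op) _).app K)
    ((NatTrans.mapHomologicalComplex (preadditiveCoyoneda.map S.f.op) _).app K) (by
      ext n x
      exact (S.zero_assoc (show S.X₃ ⟶ K.X n from x)).trans zero_comp)

/-- Injectivity of `K.X n` is needed only for surjectivity at the end, which extends a map along the
monomorphism `S.f`; the rest is left exactness of `Hom`. -/
theorem ShortExact.homTo {S : ShortComplex C} (hS : S.ShortExact) (K : CochainComplex C ℕ)
    [∀ n, Injective (K.X n)] : (S.homTo K).ShortExact :=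
  HomologicalComplex.shortExact_of_degreewise_shortExact _ fun n => by
    have := hS.epi_g
    have := hS.mono_f
    refine { exact := ?_, mono_f := ?_, epi_g := ?_ }
    · rw [ab_exact_iff]
      intro (x : S.X₂ ⟶ K.X n) (hx : S.f ≫ x = 0)
      exact ⟨hS.exact.desc x hx, hS.exact.g_desc x hx⟩
    · rw [AddCommGrpCat.mono_iff_injective]
      exact fun x y h => (cancel_epi S.g).1 h
    · rw [AddCommGrpCat.epi_iff_surjective]
      exact fun (x : S.X₁ ⟶ K.X n) => ⟨Injective.factorThru x S.f, Injective.comp_factorThru x S.f⟩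

/-- Functoriality of `homTo`. -/
noncomputable def homToMap {S S' : ShortComplex C} (φ : S ⟶ S') (K : CochainComplex C ℕ) :
    S'.homTo K ⟶ S.homTo K where
  τ₁ := (NatTrans.mapHomologicalComplex (preadditiveCoyoneda.map φ.τ₃.op) _).app K
  τ₂ := (NatTrans.mapHomologicalComplex (preadditiveCoyoneda.map φ.τ₂.op) _).app K
  τ₃ := (NatTrans.mapHomologicalComplex (preadditiveCoyoneda.map φ.τ₁.op) _).app K
  comm₁₂ := by
    ext n x
    exact (φ.comm₂₃_assoc (show S'.X₃ ⟶ K.X n from x)).symm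
  comm₂₃ := by
    ext n x
    exact (φ.comm₁₂_assoc (show S'.X₂ ⟶ K.X n from x)).symm

end CategoryTheory.ShortComplex

/-- Identifies the maps of `Ext` induced in the first variable with the homology of honest maps of
complexes on one fixed resolution. -/
theorem CategoryTheory.InjectiveResolution.rightDerived_app_comp_isoRightDerivedObj_hom
    {C : Type u} [Category.{v} C] {D : Type*} [Category* D] [Abelian C]
    [HasInjectiveResolutions C] [Abelian D] {F G : C ⥤ D} [F.Additive] [G.Additive] (α : F ⟶ G)
    {X : C} (I : InjectiveResolution X) (n : ℕ) :
    (NatTrans.rightDerived α n).app X ≫ (I.isoRightDerivedObj G n).hom =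
      (I.isoRightDerivedObj F n).hom ≫ HomologicalComplex.homologyMap
        ((NatTrans.mapHomologicalComplex α (ComplexShape.up ℕ)).app I.cocomplex) n := by
  rw [rightDerived_app_eq, Category.assoc, Category.assoc, Iso.inv_hom_id, Category.comp_id]
  rfl

namespace SlotMod

variable {d : ℕ} {T : Type u} {Γ : Type v} [AddCommMonoid T] [AddCommSemigroup Γ]
  [GammaSemiring d T Γ] {j k : Fin (d + 1)}

/-- The long exact sequences of `Ext⁽ʲᵏ⁾(-, N)`. -/
noncomputable def extContravariantSequences (N : BiMod T Γ j k) :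
    ContravariantSequences fun r => (extFunctor T Γ j k r).flip.obj N :=
  .ofCochainComplexes (fun S _ => S.homTo (injectiveResolution N).cocomplex)
    (fun _ hS => hS.homTo _)
    (fun S _ r => (injectiveResolution N).isoRightDerivedObj (homFrom S.X₁) r)
    (fun S _ r => (injectiveResolution N).isoRightDerivedObj (homFrom S.X₂) r)
    (fun S _ r => (injectiveResolution N).isoRightDerivedObj (homFrom S.X₃) r)
    (fun S _ r => (injectiveResolution N).rightDerived_app_comp_isoRightDerivedObj_hom
      (preadditiveCoyoneda.map S.f.op) r)
    (fun S _ r => (injectiveResolution N).rightDerived_app_comp_isoRightDerivedObj_hom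
      (preadditiveCoyoneda.map S.g.op) r)
    fun _ _ _ _ φ => ⟨ShortComplex.homToMap φ _,
      (injectiveResolution N).rightDerived_app_comp_isoRightDerivedObj_hom
        (preadditiveCoyoneda.map φ.τ₁.op),
      (injectiveResolution N).rightDerived_app_comp_isoRightDerivedObj_hom
        (preadditiveCoyoneda.map φ.τ₃.op)⟩

/-! ### Right exactness of the positional tensor product. -/

section

variable {ι : Type} {s : ι → Fin (d + 1)} {S : ShortComplex (SlotMod T Γ s)}

theorem shortExact_toEnv (hS : S.ShortExact) : (S.map (toEnv T Γ s)).ShortExact :=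
  hS.map_of_exact _

/-- `toEnv` is an equivalence that keeps the underlying maps, so exactness can be read off on
elements of modules over `Env`. -/
theorem function_exact_of_shortExact (hS : S.ShortExact) :
    Function.Exact S.f.hom S.g.hom :=
  (ShortComplex.ShortExact.moduleCat_exact_iff_function_exact _).1 (shortExact_toEnv hS).exact

theorem surjective_of_shortExact (hS : S.ShortExact) : Function.Surjective S.g.hom :=
  (ModuleCat.epi_iff_surjective _).1 (shortExact_toEnv hS).epi_g

end

/-- A generating relation at `m'` is the image of the relation with the same `a`, `γ`, `n` at a
preimage of `m'`, since `f` commutes with the action. -/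
theorem exists_mem_balancing_left {M M' : LeftMod T Γ j} {N : RightMod T Γ k} (f : M ⟶ M')
    (hf : Function.Surjective f.hom) {y : M' ⊗[ℤ] N} (hy : y ∈ balancing M' N) :
    ∃ x ∈ balancing M N, f.hom.toIntLinearMap.rTensor N x = y := by
  have h : balancing M' N ≤
      (balancing M N).map (f.hom.toIntLinearMap.rTensor N).toAddMonoidHom := by
    rw [balancing, AddSubgroup.closure_le]
    rintro _ ⟨a, γ, m', n, rfl⟩
    obtain ⟨m, rfl⟩ := hf m'
    exact ⟨_, AddSubgroup.subset_closure ⟨a, γ, m, n, rfl⟩, by simp [f.map_act]⟩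
  exact h hy

theorem exists_mem_balancing_right {M : LeftMod T Γ j} {N N' : RightMod T Γ k} (g : N ⟶ N')
    (hg : Function.Surjective g.hom) {y : M ⊗[ℤ] N'} (hy : y ∈ balancing M N') :
    ∃ x ∈ balancing M N, g.hom.toIntLinearMap.lTensor M x = y := by
  have h : balancing M N' ≤
      (balancing M N).map (g.hom.toIntLinearMap.lTensor M).toAddMonoidHom := by
    rw [balancing, AddSubgroup.closure_le]
    rintro _ ⟨a, γ, m, n', rfl⟩
    obtain ⟨n, rfl⟩ := hg n'
    exact ⟨_, AddSubgroup.subset_closure ⟨a, γ, m, n, rfl⟩, by simp [g.map_act]⟩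
  exact h hy

/-- Represent `z` by `t`. The image of `t` is a combination of relations, which lifts to some `b` in
`balancing M' N`. Then `t - b` dies in `M'' ⊗ N` itself, so right exactness over `ℤ` applies to it,
and `b` vanishes in the quotient. -/
theorem exists_posTensorMap_left_eq {M M' M'' : LeftMod T Γ j} (N : RightMod T Γ k) (f : M ⟶ M')
    (g : M' ⟶ M'') (hfg : Function.Exact f.hom g.hom) (hg : Function.Surjective g.hom)
    (z : PosTensor M' N) (hz : posTensorMap g (𝟙 N) z = 0) :
    ∃ x, posTensorMap f (𝟙 N) x = z := by
  obtain ⟨t, rfl⟩ := QuotientAddGroup.mk_surjective z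
  have ht : g.hom.toIntLinearMap.rTensor N t ∈ balancing M'' N :=
    (QuotientAddGroup.eq_zero_iff _).1 hz
  obtain ⟨b, hb, hbt⟩ := exists_mem_balancing_left g hg ht
  obtain ⟨x, hx⟩ := (rTensor_exact N (f := f.hom.toIntLinearMap) (g := g.hom.toIntLinearMap)
    hfg hg (t - b)).1 (by rw [map_sub, hbt, sub_self])
  refine ⟨QuotientAddGroup.mk x, ?_⟩
  change QuotientAddGroup.mk (f.hom.toIntLinearMap.rTensor N x) = _
  rw [hx, QuotientAddGroup.eq]
  simpa using hb

theorem exists_posTensorMap_right_eq {N N' N'' : RightMod T Γ k} (M : LeftMod T Γ j) (f : N ⟶ N')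
    (g : N' ⟶ N'') (hfg : Function.Exact f.hom g.hom) (hg : Function.Surjective g.hom)
    (z : PosTensor M N') (hz : posTensorMap (𝟙 M) g z = 0) :
    ∃ x, posTensorMap (𝟙 M) f x = z := by
  obtain ⟨t, rfl⟩ := QuotientAddGroup.mk_surjective z
  have ht : g.hom.toIntLinearMap.lTensor M t ∈ balancing M N'' :=
    (QuotientAddGroup.eq_zero_iff _).1 hz
  obtain ⟨b, hb, hbt⟩ := exists_mem_balancing_right g hg ht
  obtain ⟨x, hx⟩ := (lTensor_exact M (f := f.hom.toIntLinearMap) (g := g.hom.toIntLinearMap)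
    hfg hg (t - b)).1 (by rw [map_sub, hbt, sub_self])
  refine ⟨QuotientAddGroup.mk x, ?_⟩
  change QuotientAddGroup.mk (f.hom.toIntLinearMap.lTensor M x) = _
  rw [hx, QuotientAddGroup.eq]
  simpa using hb

theorem posTensorMap_left_surjective {M M' : LeftMod T Γ j} (N : RightMod T Γ k) (g : M ⟶ M')
    (hg : Function.Surjective g.hom) : Function.Surjective (posTensorMap g (𝟙 N)) := by
  intro z
  obtain ⟨t, rfl⟩ := QuotientAddGroup.mk_surjective z
  obtain ⟨x, rfl⟩ := LinearMap.rTensor_surjective N (g := g.hom.toIntLinearMap) hg t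
  exact ⟨QuotientAddGroup.mk x, rfl⟩

theorem posTensorMap_right_surjective {N N' : RightMod T Γ k} (M : LeftMod T Γ j) (g : N ⟶ N')
    (hg : Function.Surjective g.hom) : Function.Surjective (posTensorMap (𝟙 M) g) := by
  intro z
  obtain ⟨t, rfl⟩ := QuotientAddGroup.mk_surjective z
  obtain ⟨x, rfl⟩ := LinearMap.lTensor_surjective M (g := g.hom.toIntLinearMap) hg t
  exact ⟨QuotientAddGroup.mk x, rfl⟩

instance preservesFiniteColimits_biTensorRight (N : RightMod T Γ k) :
    PreservesFiniteColimits (biTensorRight (j := j) N) := by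
  rw [Functor.preservesFiniteColimits_iff_forall_exact_map_and_epi]
  intro S hS
  refine ⟨(ShortComplex.ab_exact_iff _).2 fun z hz => ?_,
    (AddCommGrpCat.epi_iff_surjective _).2 ?_⟩
  -- `toLeft` only forgets an action, so exactness on elements of bi-modules serves for the left
  -- modules as it stands.
  · exact exists_posTensorMap_left_eq N (toLeft.map S.f) (toLeft.map S.g)
      (function_exact_of_shortExact hS) (surjective_of_shortExact hS) z hz
  · exact posTensorMap_left_surjective N (toLeft.map S.g) (surjective_of_shortExact hS)

instance preservesFiniteColimits_biTensorLeft (M : LeftMod T Γ j) :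
    PreservesFiniteColimits (biTensorLeft (k := k) M) := by
  rw [Functor.preservesFiniteColimits_iff_forall_exact_map_and_epi]
  intro S hS
  refine ⟨(ShortComplex.ab_exact_iff _).2 fun z hz => ?_,
    (AddCommGrpCat.epi_iff_surjective _).2 ?_⟩
  · exact exists_posTensorMap_right_eq M (toRight.map S.f) (toRight.map S.g)
      (function_exact_of_shortExact hS) (surjective_of_shortExact hS) z hz
  · exact posTensorMap_right_surjective M (toRight.map S.g) (surjective_of_shortExact hS)

end SlotMod

theorem mainTheorem5 {d : ℕ} (hd : 1 ≤ d) (T : Type u) (Γ : Type v) [AddCommMonoid T]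
    [AddCommSemigroup Γ] [GammaSemiring d T Γ] (j k : Fin (d + 1)) :
    (∀ M : BiMod T Γ j k,
      IsIso (SlotMod.homFrom M).toRightDerivedZero ∧
        Nonempty (CohomologicalSequences fun r =>
          (SlotMod.extFunctor T Γ j k r).obj (Opposite.op M))) ∧
    (∀ N : BiMod T Γ j k,
      Nonempty (ContravariantSequences fun r => (SlotMod.extFunctor T Γ j k r).flip.obj N)) ∧
    (∀ N : RightMod T Γ k,
      IsIso (SlotMod.biTensorRight (j := j) N).fromLeftDerivedZero ∧
        Nonempty (HomologicalSequences (SlotMod.torRight j N))) ∧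
    (∀ M : LeftMod T Γ j,
      IsIso (SlotMod.biTensorLeft (k := k) M).fromLeftDerivedZero ∧
        Nonempty (HomologicalSequences (SlotMod.torLeft k M))) :=
  -- The degree-zero isomorphisms found by instance search rest on left exactness of `homFrom M`
  -- here, and on the right exactness instances for the tensor functors below.
  ⟨fun M => ⟨inferInstance, ⟨(SlotMod.homFrom M).cohomologicalSequences⟩⟩,
    fun N => ⟨SlotMod.extContravariantSequences N⟩,
    fun N => ⟨inferInstance, ⟨(SlotMod.biTensorRight N).homologicalSequences⟩⟩,
    fun M => ⟨inferInstance, ⟨(SlotMod.biTensorLeft M).homologicalSequences⟩⟩⟩
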